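/- Fix many-sorted first-order logic with equality. For a signature $\Sigma$ whose symbols are effectively coded by natural numbers, a $\Sigma$-theory $\mathcal T$ is the class of all $\Sigma$-interpretations (structures with non-empty domains together with values of all variables) that satisfy a set of sentences, and $QF(\Sigma)$ is the set of quantifier-free formulas. Let $R$ be a set of sorts of $\Sigma$. * $\mathcal T$ is *decidable* if the set of $\mathcal T$-satisfiable formulas in $QF(\Sigma)$ is decidable. * $\mathcal T$ is *stably infinite* w.r.t. $R$ if every $\mathcal T$-satisfiable $\varphi\in QF(\Sigma)$ is satisfied by some $\mathcal T$-interpretation whose domains of the sorts in $R$ are infinite. * $\mathcal T$ is *smooth* w.r.t. $R$ if for every $\varphi\in QF(\Sigma)$, every $\mathcal T$-interpretation $\mathcal A\models\varphi$ and all cardinals $\kappa(\sigma)\ge|\sigma^{\mathcal A}|$ ($\sigma\in R$) there is a $\mathcal T$-interpretation $\mathcal B\models\varphi$ with $|\sigma^{\mathcal B}|=\kappa(\sigma)$ for all $\sigma\in R$. * $\mathcal T$ is *stably finite* w.r.t. $R$ if for every $\varphi\in QF(\Sigma)$ and $\mathcal T$-interpretation $\mathcal A\models\varphi$ there is a $\mathcal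 T$-interpretation $\mathcal B\models\varphi$ with $|\sigma^{\mathcal B}|$ finite and at most $|\sigma^{\mathcal A}|$ for all $\sigma\in R$. * $\mathcal T$ is *strongly finitely witnessable* w.r.t. $R$ if there is a computable $wit:QF(\Sigma)\to QF(\Sigma)$ such that for every $\varphi\in QF(\Sigma)$: (i) $\varphi$ and $\exists\vec x\,wit(\varphi)$ are satisfied by the same $\mathcal T$-interpretations, where $\vec x$ lists the variables of $wit(\varphi)$ that do not occur in $\varphi$; (ii) if $wit(\varphi)$ is $\mathcal T$-satisfiable, there is a $\mathcal T$-interpretation $\mathcal A\models\varphi$ in which, for each $\sigma\in R$, every element of $\sigma^{\mathcal A}$ is the value of a variable of sort $\sigma$ in $wit(\varphi)$; (iii) for every finite set $V$ of variables with sorts in $R$ and every arrangement $\delta_V$ (the conjunction of the equalities $x=y$ or disequalities $x\ne y$ of variables in $V$ prescribed by a sort-respecting equivalence relation on $V$), if $wit(\varphi)\wedge\delta_V$ is $\mathcal T$-satisfiable, then there is a $\mathcal T$-interpretation $\mathcal A\models wit(\varphi)\wedge\delta_V$ in which, for each $\sigma\in R$, every element of $\sigma^{\mathcal A}$ is the value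 of a variable of sort $\sigma$ in $wit(\varphi)\wedge\delta_V$. * $\mathcal T$ is *strongly polite* w.r.t. $R$ if it is smooth and strongly finitely witnessable w.r.t. $R$. * A *minimal model function* w.r.t. $R$ assigns to each $\varphi\in QF(\Sigma)$ a set $MM(\varphi)$ of functions from $R$ to the cardinals such that, if $\varphi$ is $\mathcal T$-satisfiable: every $\mathbf n\in MM(\varphi)$ is $\sigma\mapsto|\sigma^{\mathcal A}|$ for some $\mathcal T$-interpretation $\mathcal A\models\varphi$; for distinct $\mathbf m,\mathbf n\in MM(\varphi)$ there is $\sigma\in R$ with $\mathbf m(\sigma)<\mathbf n(\sigma)$; and for every $\mathcal T$-interpretation $\mathcal A\models\varphi$ there is $\mathbf n\in MM(\varphi)$ with $\mathbf n(\sigma)\le|\sigma^{\mathcal A}|$ for all $\sigma\in R$. It is *computable* if a total algorithm returns, for every $\varphi\in QF(\Sigma)$, the set $MM(\varphi)$ as a finite list of functions from $R$ to $\mathbb N\cup\{\aleph_0\}$, each given by a finite table. * $\mathcal T$ is *shiny* w.r.t. $R$ if it is smooth, stably finite and has a computable minimal model function, all w.r.t. $R$. It is a *Unicorn 2.0 theory*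 w.r.t. $R$ if it is strongly finitely witnessable but has no computable minimal model function w.r.t. $R$. **Statement.** There are theories that are strongly polite, but neither shiny nor decidable, with respect to the same finite set of sorts. More precisely, let $\Sigma_f$ have one sort $\sigma_1$ and one unary function symbol $f$, and let $cycle_n(x)$ be the formula $f^n(x)=x\wedge\bigwedge_{m\mid n,\,m\ne n}f^m(x)\ne x$. For a set $S$ of natural numbers let $\mathcal T_1$ be axiomatized by $(\exists x\,cycle_n(x))\to\forall x\,f^2(x)\ne x$ for $n\in S$, and let $\mathcal T_2$ be axiomatized by the axioms of $\mathcal T_1$ and $\neg\exists x\,cycle_6(x)$. There exist undecidable sets of primes that are at least $7$; and for every such set $S$, each of $\mathcal T_1$ and $\mathcal T_2$ is stably infinite, a Unicorn 2.0 theory, strongly polite and not shiny, all w.r.t. $\{\sigma_1\}$, and is not decidable. -/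

import Mathlib

universe u

namespace ManySorted

/-! ### Many-sorted first-order logic -/

/-- A many-sorted signature. The equality symbols are part of the logic and not listed in `Pred`. -/
structure Signature where
  Sorts : Type
  sorts_nonempty : Nonempty Sorts
  Fn : Type
  Pred : Type
  fnArgs : Fn → List Sorts
  fnRes : Fn → Sorts
  predArgs : Pred → List Sorts

/-- An effective presentation of a signature: symbols are coded by natural numbers, and the
arities can be computed. Every notion that mentions an algorithm refers to such a presentation. -/
class Signature.Effective (Sg : Signature) where
  codeSorts : Primcodable Sg.Sorts
  codeFn : Primcodable Sg.Fn
  codePred : Primcodable Sg.Pred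
  computable_fnArgs : Computable Sg.fnArgs
  computable_fnRes : Computable Sg.fnRes
  computable_predArgs : Computable Sg.predArgs

attribute [reducible, instance] Signature.Effective.codeSorts Signature.Effective.codeFn
  Signature.Effective.codePred

/-- Variables: countably many of each sort. -/
@[ext] structure Signature.Var (Sg : Signature) where
  sort : Sg.Sorts
  idx : ℕ

/-- Terms, indexed by their sort; `var s n` is the variable of sort `s` with index `n`. -/
inductive Term (Sg : Signature) : Sg.Sorts → Type
  | var (s : Sg.Sorts) (n : ℕ) : Term Sg s
  | app (f : Sg.Fn) (args : ∀ i : Fin (Sg.fnArgs f).length, Term Sg ((Sg.fnArgs f).get i)) :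
      Term Sg (Sg.fnRes f)

inductive Formula (Sg : Signature) : Type
  | fal : Formula Sg
  | eq (s : Sg.Sorts) (t t' : Term Sg s) : Formula Sg
  | rel (P : Sg.Pred) (args : ∀ i : Fin (Sg.predArgs P).length, Term Sg ((Sg.predArgs P).get i)) :
      Formula Sg
  | not (φ : Formula Sg) : Formula Sg
  | and (φ ψ : Formula Sg) : Formula Sg
  | or (φ ψ : Formula Sg) : Formula Sg
  | imp (φ ψ : Formula Sg) : Formula Sg
  | all (v : Sg.Var) (φ : Formula Sg) : Formula Sg
  | ex (v : Sg.Var) (φ : Formula Sg) : Formula Sg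

variable {Sg : Signature}

open Classical in
/-- The variables of a term. -/
noncomputable def Term.vars : {s : Sg.Sorts} → Term Sg s → Finset Sg.Var
  | _, .var s n => {⟨s, n⟩}
  | _, .app _ args => Finset.univ.biUnion fun i => (args i).vars

open Classical in
/-- The free variables of a formula. -/
noncomputable def Formula.vars : Formula Sg → Finset Sg.Var
  | .fal => ∅
  | .eq _ t t' => t.vars ∪ t'.vars
  | .rel _ args => Finset.univ.biUnion fun i => (args i).vars
  | .not φ => φ.vars
  | .and φ ψ => φ.vars ∪ ψ.vars
  | .or φ ψ => φ.vars ∪ ψ.vars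
  | .imp φ ψ => φ.vars ∪ ψ.vars
  | .all v φ => φ.vars.erase v
  | .ex v φ => φ.vars.erase v

def Formula.IsQF : Formula Sg → Prop
  | .fal => True
  | .eq _ _ _ => True
  | .rel _ _ => True
  | .not φ => φ.IsQF
  | .and φ ψ => φ.IsQF ∧ ψ.IsQF
  | .or φ ψ => φ.IsQF ∧ ψ.IsQF
  | .imp φ ψ => φ.IsQF ∧ ψ.IsQF
  | .all _ _ => False
  | .ex _ _ => False

/-- Quantifier-free formulas. -/
abbrev QF (Sg : Signature) : Type := {φ : Formula Sg // φ.IsQF}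

/-- Conjunction of a finite list of formulas; the empty conjunction is true. -/
def Formula.conj (l : List (Formula Sg)) : Formula Sg :=
  l.foldr Formula.and (.not .fal)

/-- Existential quantification over a finite list of variables. -/
def Formula.exs (l : List Sg.Var) (φ : Formula Sg) : Formula Sg :=
  l.foldr Formula.ex φ

/-! ### Semantics -/

structure Struct (Sg : Signature) where
  Dom : Sg.Sorts → Type u
  dom_nonempty : ∀ s, Nonempty (Dom s)
  fn : ∀ f : Sg.Fn, (∀ i : Fin (Sg.fnArgs f).length, Dom ((Sg.fnArgs f).get i)) → Dom (Sg.fnRes f)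
  rel : ∀ P : Sg.Pred, (∀ i : Fin (Sg.predArgs P).length, Dom ((Sg.predArgs P).get i)) → Prop

/-- An interpretation: a structure together with values of all variables. -/
structure Interp (Sg : Signature) extends Struct.{u} Sg where
  val : ∀ v : Sg.Var, Dom v.sort

def Term.eval (M : Struct.{u} Sg) (ν : ∀ v : Sg.Var, M.Dom v.sort) :
    {s : Sg.Sorts} → Term Sg s → M.Dom s
  | _, .var s n => ν ⟨s, n⟩
  | _, .app f args => M.fn f fun i => (args i).eval M ν

open Classical in
def Formula.Sat (M : Struct.{u} Sg) : Formula Sg → (∀ v : Sg.Var, M.Dom v.sort) → Prop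
  | .fal, _ => False
  | .eq _ t t', ν => t.eval M ν = t'.eval M ν
  | .rel P args, ν => M.rel P fun i => (args i).eval M ν
  | .not φ, ν => ¬ φ.Sat M ν
  | .and φ ψ, ν => φ.Sat M ν ∧ ψ.Sat M ν
  | .or φ ψ, ν => φ.Sat M ν ∨ ψ.Sat M ν
  | .imp φ ψ, ν => φ.Sat M ν → ψ.Sat M ν
  | .all v φ, ν => ∀ a : M.Dom v.sort, φ.Sat M (Function.update ν v a)
  | .ex v φ, ν => ∃ a : M.Dom v.sort, φ.Sat M (Function.update ν v a)

def Interp.Models (A : Interp.{u} Sg) (φ : Formula Sg) : Prop := φ.Sat A.toStruct A.val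

/-- A theory, given by its axioms, which are sentences. -/
structure Theory (Sg : Signature) where
  ax : Set (Formula Sg)
  closed : ∀ φ ∈ ax, φ.vars = ∅

/-- `A` is a `T`-interpretation. -/
def Theory.IsInterp (T : Theory Sg) (A : Interp.{u} Sg) : Prop := ∀ φ ∈ T.ax, A.Models φ

def Theory.Satisfiable (T : Theory Sg) (φ : Formula Sg) : Prop :=
  ∃ A : Interp.{u} Sg, T.IsInterp A ∧ A.Models φ

def Theory.Equivalent (T : Theory Sg) (φ ψ : Formula Sg) : Prop :=
  ∀ A : Interp.{u} Sg, T.IsInterp A → (A.Models φ ↔ A.Models ψ)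

/-! ### Gödel numbering -/

section Coding

variable [Sg.Effective]

def Term.code : {s : Sg.Sorts} → Term Sg s → ℕ
  | _, .var s n => Nat.pair 0 (Nat.pair (Encodable.encode s) n)
  | _, .app f args =>
      Nat.pair 1 (Nat.pair (Encodable.encode f) (Encodable.encode (List.ofFn fun i => (args i).code)))

def Formula.code : Formula Sg → ℕ
  | .fal => Nat.pair 0 0
  | .eq s t t' => Nat.pair 1 (Nat.pair (Encodable.encode s) (Nat.pair t.code t'.code))
  | .rel P args =>
      Nat.pair 2 (Nat.pair (Encodable.encode P) (Encodable.encode (List.ofFn fun i => (args i).code)))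
  | .not φ => Nat.pair 3 φ.code
  | .and φ ψ => Nat.pair 4 (Nat.pair φ.code ψ.code)
  | .or φ ψ => Nat.pair 5 (Nat.pair φ.code ψ.code)
  | .imp φ ψ => Nat.pair 6 (Nat.pair φ.code ψ.code)
  | .all v φ => Nat.pair 7 (Nat.pair (Nat.pair (Encodable.encode v.sort) v.idx) φ.code)
  | .ex v φ => Nat.pair 8 (Nat.pair (Nat.pair (Encodable.encode v.sort) v.idx) φ.code)

/-- A term is determined, together with its sort, by its code. -/
theorem Term.code_injective {s s' : Sg.Sorts} (t : Term Sg s) (t' : Term Sg s')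
    (h : t.code = t'.code) : s = s' ∧ HEq t t' := by
  induction t generalizing s' with
  | var s n =>
    cases t' with
    | var s' n' =>
      simp only [Term.code, Nat.pair_eq_pair, Encodable.encode_inj, true_and] at h
      obtain ⟨rfl, rfl⟩ := h
      exact ⟨rfl, HEq.rfl⟩
    | app f args => simp [Term.code] at h
  | app f args ih =>
    cases t' with
    | var s' n' => simp [Term.code] at h
    | app f' args' =>
      simp only [Term.code, Nat.pair_eq_pair, Encodable.encode_inj, true_and] at h
      obtain ⟨rfl, h⟩ := h
      have h' := List.ofFn_injective h
      have : args = args' := funext fun i => eq_of_heq (ih i (args' i) (congrFun h' i)).2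
      subst this
      exact ⟨rfl, HEq.rfl⟩

/-- Distinct formulas have distinct codes. -/
theorem Formula.code_injective : Function.Injective (Formula.code (Sg := Sg)) := by
  intro φ
  induction φ with
  | fal => intro ψ h; cases ψ <;> simp [Formula.code] at h ⊢
  | eq s t t' =>
    intro ψ h
    cases ψ <;> simp only [Formula.code, Nat.pair_eq_pair, Encodable.encode_inj] at h
    case eq s' r r' =>
      obtain ⟨-, rfl, h1, h2⟩ := h
      rw [eq_of_heq (Term.code_injective _ _ h1).2, eq_of_heq (Term.code_injective _ _ h2).2]
    all_goals omega
  | rel P args =>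
    intro ψ h
    cases ψ <;> simp only [Formula.code, Nat.pair_eq_pair, Encodable.encode_inj] at h
    case rel P' args' =>
      obtain ⟨-, rfl, h⟩ := h
      have h' := List.ofFn_injective h
      have : args = args' :=
        funext fun i => eq_of_heq (Term.code_injective _ _ (congrFun h' i)).2
      rw [this]
    all_goals omega
  | not φ ih =>
    intro ψ h
    cases ψ <;> simp only [Formula.code, Nat.pair_eq_pair] at h
    case not ψ => rw [ih h.2]
    all_goals omega
  | and φ φ' ih ih' =>
    intro ψ h
    cases ψ <;> simp only [Formula.code, Nat.pair_eq_pair] at h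
    case and ψ ψ' => rw [ih h.2.1, ih' h.2.2]
    all_goals omega
  | or φ φ' ih ih' =>
    intro ψ h
    cases ψ <;> simp only [Formula.code, Nat.pair_eq_pair] at h
    case or ψ ψ' => rw [ih h.2.1, ih' h.2.2]
    all_goals omega
  | imp φ φ' ih ih' =>
    intro ψ h
    cases ψ <;> simp only [Formula.code, Nat.pair_eq_pair] at h
    case imp ψ ψ' => rw [ih h.2.1, ih' h.2.2]
    all_goals omega
  | all v φ ih =>
    intro ψ h
    cases ψ <;> simp only [Formula.code, Nat.pair_eq_pair, Encodable.encode_inj] at h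
    case all w ψ => rw [ih h.2.2, Signature.Var.ext h.2.1.1 h.2.1.2]
    all_goals omega
  | ex v φ ih =>
    intro ψ h
    cases ψ <;> simp only [Formula.code, Nat.pair_eq_pair, Encodable.encode_inj] at h
    case ex w ψ => rw [ih h.2.2, Signature.Var.ext h.2.1.1 h.2.1.2]
    all_goals omega

end Coding

/-! ### Theory combination properties, with respect to a set `R` of sorts -/

/-- It is decidable whether a quantifier-free formula is `T`-satisfiable. -/
def Theory.IsDecidable [Sg.Effective] (T : Theory Sg) : Prop :=
  ∃ d : ℕ → Bool, Computable d ∧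
    ∀ φ : QF Sg, d φ.1.code = true ↔ T.Satisfiable.{u} φ.1

def Theory.StablyInfinite (T : Theory Sg) (R : Set Sg.Sorts) : Prop :=
  ∀ φ : QF Sg, T.Satisfiable.{u} φ.1 →
    ∃ A : Interp.{u} Sg, T.IsInterp A ∧ A.Models φ.1 ∧
      ∀ s ∈ R, Cardinal.aleph0 ≤ Cardinal.mk (A.Dom s)

def Theory.Smooth (T : Theory Sg) (R : Set Sg.Sorts) : Prop :=
  ∀ (φ : QF Sg) (A : Interp.{u} Sg), T.IsInterp A → A.Models φ.1 →
    ∀ κ : R → Cardinal.{u}, (∀ s : R, Cardinal.mk (A.Dom s) ≤ κ s) →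
      ∃ B : Interp.{u} Sg, T.IsInterp B ∧ B.Models φ.1 ∧ ∀ s : R, Cardinal.mk (B.Dom s) = κ s

def Theory.StablyFinite (T : Theory Sg) (R : Set Sg.Sorts) : Prop :=
  ∀ (φ : QF Sg) (A : Interp.{u} Sg), T.IsInterp A → A.Models φ.1 →
    ∃ B : Interp.{u} Sg, T.IsInterp B ∧ B.Models φ.1 ∧
      ∀ s ∈ R, Cardinal.mk (B.Dom s) < Cardinal.aleph0 ∧
        Cardinal.mk (B.Dom s) ≤ Cardinal.mk (A.Dom s)

open Classical in
/-- The arrangement on `V` induced by `E`: the conjunction, over the pairs of variables of equal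
sort in `V`, of `x = y` if `E` relates `x` and `y`, and of `¬ x = y` otherwise. -/
noncomputable def arrangement (V : Finset Sg.Var) (E : Setoid Sg.Var) : Formula Sg :=
  Formula.conj (((V ×ˢ V).filter fun p => p.1.sort = p.2.sort).toList.map fun p =>
    if E p.1 p.2 then .eq p.1.sort (.var p.1.sort p.1.idx) (.var p.1.sort p.2.idx)
    else .not (.eq p.1.sort (.var p.1.sort p.1.idx) (.var p.1.sort p.2.idx)))

/-- In `A`, every element of a sort in `R` is the value of a variable of that sort in `V`. -/
def Interp.CoveredBy (A : Interp.{u} Sg) (R : Set Sg.Sorts) (V : Finset Sg.Var) : Prop :=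
  ∀ s ∈ R, ∀ a : A.Dom s, ∃ n : ℕ, (⟨s, n⟩ : Sg.Var) ∈ V ∧ A.val ⟨s, n⟩ = a

open Classical in
def Theory.IsWitness [Sg.Effective] (T : Theory Sg) (R : Set Sg.Sorts) (wit : QF Sg → QF Sg) :
    Prop :=
  (∃ h : ℕ → ℕ, Computable h ∧ ∀ φ : QF Sg, h φ.1.code = (wit φ).1.code) ∧
  (∀ φ : QF Sg,
    T.Equivalent.{u} φ.1 (Formula.exs ((wit φ).1.vars \ φ.1.vars).toList (wit φ).1)) ∧
  ∀ φ : QF Sg, T.Satisfiable.{u} (wit φ).1 →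
    ∃ A : Interp.{u} Sg, T.IsInterp A ∧ A.Models φ.1 ∧ A.CoveredBy R (wit φ).1.vars

def Theory.IsStrongWitness [Sg.Effective] (T : Theory Sg) (R : Set Sg.Sorts)
    (wit : QF Sg → QF Sg) : Prop :=
  T.IsWitness.{u} R wit ∧
  ∀ (φ : QF Sg) (V : Finset Sg.Var) (E : Setoid Sg.Var), (∀ v ∈ V, v.sort ∈ R) →
    (∀ x ∈ V, ∀ y ∈ V, E x y → x.sort = y.sort) →
    T.Satisfiable.{u} (.and (wit φ).1 (arrangement V E)) →
      ∃ A : Interp.{u} Sg, T.IsInterp A ∧ A.Models (.and (wit φ).1 (arrangement V E)) ∧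
        A.CoveredBy R (Formula.and (wit φ).1 (arrangement V E)).vars

def Theory.StronglyFinitelyWitnessable [Sg.Effective] (T : Theory Sg) (R : Set Sg.Sorts) : Prop :=
  ∃ wit : QF Sg → QF Sg, T.IsStrongWitness.{u} R wit

def Theory.StronglyPolite [Sg.Effective] (T : Theory Sg) (R : Set Sg.Sorts) : Prop :=
  T.Smooth.{u} R ∧ T.StronglyFinitelyWitnessable.{u} R

/-- Minimal model functions; nothing is required at formulas that are not `T`-satisfiable. -/
def Theory.IsMinimalModelFunction (T : Theory Sg) (R : Set Sg.Sorts)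
    (MM : QF Sg → Set (R → Cardinal.{u})) : Prop :=
  ∀ φ : QF Sg, T.Satisfiable.{u} φ.1 →
    (∀ n ∈ MM φ, ∃ A : Interp.{u} Sg, T.IsInterp A ∧ A.Models φ.1 ∧
      ∀ s : R, n s = Cardinal.mk (A.Dom s)) ∧
    (∀ m ∈ MM φ, ∀ n ∈ MM φ, m ≠ n → ∃ s : R, m s < n s) ∧
    ∀ A : Interp.{u} Sg, T.IsInterp A → A.Models φ.1 →
      ∃ n ∈ MM φ, ∀ s : R, n s ≤ Cardinal.mk (A.Dom s)

/-- The cardinal denoted by an element of `ℕ ∪ {ℵ₀}`, where `none` stands for `ℵ₀`. -/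
noncomputable def toCard : Option ℕ → Cardinal.{u}
  | none => Cardinal.aleph0
  | some k => k

/-- The finite table `row` is the graph of `n` on `R`. -/
def IsTable {R : Set Sg.Sorts} (row : List (Sg.Sorts × Option ℕ)) (n : R → Cardinal.{u}) : Prop :=
  ∀ (s : R) (c : Cardinal.{u}), n s = c ↔ ∃ v, (s.1, v) ∈ row ∧ toCard v = c

/-- `MM` is computable: an algorithm, total on all quantifier-free formulas, returns the finite set
`MM φ`, as a list of tables of functions from `R` to `ℕ ∪ {ℵ₀}`. -/
def IsComputableMMF [Sg.Effective] {R : Set Sg.Sorts} (MM : QF Sg → Set (R → Cardinal.{u})) :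
    Prop :=
  ∃ h : ℕ → List (List (Sg.Sorts × Option ℕ)), Computable h ∧
    ∀ φ : QF Sg, MM φ = {n | ∃ row ∈ h φ.1.code, IsTable row n}

def Theory.HasComputableMMF [Sg.Effective] (T : Theory Sg) (R : Set Sg.Sorts) : Prop :=
  ∃ MM : QF Sg → Set (R → Cardinal.{u}), T.IsMinimalModelFunction R MM ∧ IsComputableMMF MM

def Theory.Shiny [Sg.Effective] (T : Theory Sg) (R : Set Sg.Sorts) : Prop :=
  T.Smooth.{u} R ∧ T.StablyFinite.{u} R ∧ T.HasComputableMMF.{u} R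

def Theory.Unicorn2 [Sg.Effective] (T : Theory Sg) (R : Set Sg.Sorts) : Prop :=
  T.StronglyFinitelyWitnessable.{u} R ∧ ¬ T.HasComputableMMF.{u} R

/-! ### The theories -/

/-- One sort and one unary function symbol. -/
abbrev sigF : Signature where
  Sorts := Unit
  sorts_nonempty := ⟨()⟩
  Fn := Unit
  Pred := Empty
  fnArgs _ := [()]
  fnRes _ := ()
  predArgs P := P.elim

instance : sigF.Effective where
  codeSorts := inferInstanceAs (Primcodable Unit)
  codeFn := inferInstanceAs (Primcodable Unit)
  codePred := inferInstanceAs (Primcodable Empty)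
  computable_fnArgs := @Computable.const Unit (List Unit) _ _ [()]
  computable_fnRes := @Computable.const Unit Unit _ _ ()
  computable_predArgs :=
    @Primrec.to_comp Empty (List Unit) _ _ _ ((Nat.Primrec.const 0).of_eq fun _ => rfl)

/-- The variable with index `i`, as a term. -/
def xvar (i : ℕ) : Term sigF () := .var (Sg := sigF) () i

/-- The term `f^k (x_i)`. -/
def fpow (i : ℕ) : ℕ → Term sigF ()
  | 0 => xvar i
  | k + 1 => .app (Sg := sigF) () fun _ => fpow i k

/-- The formula `cycle_n (x_i)`. -/
noncomputable def cycle (n i : ℕ) : Formula sigF :=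
  .and (.eq () (fpow i n) (xvar i))
    (Formula.conj (n.properDivisors.toList.map fun m => .not (.eq () (fpow i m) (xvar i))))

/-- The sentence `(∃ x, cycle_n (x)) → ∀ x, f² (x) ≠ x`. -/
noncomputable def cycleAxiom (n : ℕ) : Formula sigF :=
  .imp (.ex ⟨(), 0⟩ (cycle n 0)) (.all ⟨(), 0⟩ (.not (.eq () (fpow 0 2) (xvar 0))))

theorem fpow_vars (i k : ℕ) : (fpow i k).vars = {(⟨(), i⟩ : sigF.Var)} := by
  induction k with
  | zero => rfl
  | succ k ih =>
    ext v
    simp only [fpow, Term.vars, Finset.mem_biUnion, Finset.mem_univ, true_and]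
    rw [← ih]
    exact ⟨fun ⟨_, h⟩ => h, fun h => ⟨⟨0, Nat.one_pos⟩, h⟩⟩

theorem cycle_vars (n i : ℕ) : (cycle n i).vars = {(⟨(), i⟩ : sigF.Var)} := by
  have hx : (xvar i).vars = {(⟨(), i⟩ : sigF.Var)} := fpow_vars i 0
  have key : ∀ l : List ℕ, ∀ v ∈
      (Formula.conj (l.map fun m => Formula.not (.eq () (fpow i m) (xvar i)))).vars,
        v = (⟨(), i⟩ : sigF.Var) := by
    intro l
    induction l with
    | nil => simp [Formula.conj, Formula.vars]
    | cons m l ih =>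
      intro v hv
      change v ∈ (Formula.and _ (Formula.conj (l.map _))).vars at hv
      simp only [Formula.vars, fpow_vars, hx, Finset.mem_union, Finset.mem_singleton, or_self] at hv
      exact hv.elim id (ih v)
  ext v
  simp only [cycle, Formula.vars, fpow_vars, hx, Finset.mem_union, Finset.mem_singleton, or_self]
  exact ⟨fun h => h.elim id (key _ v), Or.inl⟩

theorem cycleAxiom_vars (n : ℕ) : (cycleAxiom n).vars = ∅ := by
  have h : (xvar 0).vars = {(⟨(), 0⟩ : sigF.Var)} := fpow_vars 0 0
  simp [cycleAxiom, Formula.vars, cycle_vars, fpow_vars, h]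

/-- The theory axiomatized by `(∃ x, cycle_n (x)) → ∀ x, f² (x) ≠ x` for `n ∈ S`. -/
noncomputable def T₁ (S : Set ℕ) : Theory sigF where
  ax := {φ | ∃ n ∈ S, φ = cycleAxiom n}
  closed := by
    rintro φ ⟨n, -, rfl⟩
    exact cycleAxiom_vars n

/-- The theory obtained from `T₁ S` by adding the axiom `¬ ∃ x, cycle_6 (x)`. -/
noncomputable def T₂ (S : Set ℕ) : Theory sigF where
  ax := (T₁ S).ax ∪ {.not (.ex ⟨(), 0⟩ (cycle 6 0))}
  closed := by
    rintro φ (h | rfl)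
    · exact (T₁ S).closed φ h
    · simp [Formula.vars, cycle_vars]

/-- `S` is an undecidable set of primes that are at least `7`. -/
def IsUndecidablePrimeSet (S : Set ℕ) : Prop :=
  (∀ p ∈ S, p.Prime ∧ 7 ≤ p) ∧ ¬ ComputablePred fun n : ℕ => n ∈ S

end ManySorted

/-! Whether an interpretation satisfies the axioms of either theory depends only on the set of cycle
lengths of `f`, through a condition that passes to subsets and allows the set `{1}`.
`IsPeriodTheory` isolates this, so both theories are treated at once.

Positive half. Adding new points that `f` sends to one old point creates no cycle; this gives
smoothness, hence stable infiniteness. For the strong witness, fresh variables name all `f^j (x_i)`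
that can matter for `φ`. A model of the witness is then cut down to the values `W` of the variables
present, and `f` is redefined only where it leaves `W`. By `exists_restrict_periods` this creates no
new cycle length, except that the only cycle may be a fixed point, and both outcomes are admissible.
The construction never consults `S`, so it is computable although `S` is not.

Negative half. For `n ≥ 7`, an `n`-cycle may coexist with a fixed point exactly when `n ∉ S`. So
deciding whether "`x₀` lies on an `n`-cycle and `f x₁ = x₁`" is satisfiable would decide `S`. For
minimal models the second conjunct is weakened to `f^3 x₁ = x₁`: a 3-cycle next to the `n`-cycle is
always allowed, so the formula is always satisfiable, but its least model has `n + 1` elements if `n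
∉ S` and `n + 3` if `n ∈ S`. A computable minimal model function would again decide `S`, which rules
out shininess. -/

open Function

/-! ### Periods of self-maps -/

/-- The set of lengths of the cycles of a self-map. -/
def periods {α : Type*} (f : α → α) : Set ℕ := {n | 0 < n ∧ ∃ x, minimalPeriod f x = n}

theorem mem_periods {α : Type*} {f : α → α} {n : ℕ} :
    n ∈ periods f ↔ 0 < n ∧ ∃ x, minimalPeriod f x = n := Iff.rfl

theorem forall_properDivisors_ne_iff_minimalPeriod_eq {α : Type*} {f : α → α} {n : ℕ} (hn : 0 < n)
    (x : α) :
    (f^[n] x = x ∧ ∀ m ∈ n.properDivisors, f^[m] x ≠ x) ↔ minimalPeriod f x = n := by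
  constructor
  · rintro ⟨h, h'⟩
    by_contra hne
    have hd : minimalPeriod f x ∣ n := IsPeriodicPt.minimalPeriod_dvd h
    exact h' _ (Nat.mem_properDivisors.2 ⟨hd, lt_of_le_of_ne (Nat.le_of_dvd hn hd) hne⟩)
      (isPeriodicPt_minimalPeriod f x)
  · rintro rfl
    refine ⟨isPeriodicPt_minimalPeriod f x, fun m hm h => ?_⟩
    rw [Nat.mem_properDivisors] at hm
    have h2 := IsPeriodicPt.minimalPeriod_dvd (f := f) (n := m) (x := x) h
    exact absurd (Nat.le_of_dvd (Nat.pos_of_dvd_of_pos hm.1 hn) h2) (not_le.2 hm.2)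

/-- The variant that matches `noReturn`: excluding all smaller exponents, not only the proper
divisors, gives a formula whose code comes from a plain recursion. -/
theorem forall_lt_ne_iff_minimalPeriod_eq {α : Type*} {f : α → α} {n : ℕ} (hn : 0 < n) (x : α) :
    (f^[n] x = x ∧ ∀ m, 0 < m → m < n → f^[m] x ≠ x) ↔ minimalPeriod f x = n := by
  constructor
  · rintro ⟨h, h'⟩
    by_contra hne
    have hp : IsPeriodicPt f n x := h
    exact h' _ (hp.minimalPeriod_pos hn) (lt_of_le_of_ne (hp.minimalPeriod_le hn) hne)
      (isPeriodicPt_minimalPeriod f x)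
  · rintro rfl
    exact ⟨isPeriodicPt_minimalPeriod f x, fun m hm hlt h =>
      absurd (IsPeriodicPt.minimalPeriod_le (f := f) hm h) (not_le.2 hlt)⟩

theorem forall_iterate_two_ne_iff_periods {α : Type*} {f : α → α} :
    (∀ x, f^[2] x ≠ x) ↔ 1 ∉ periods f ∧ 2 ∉ periods f := by
  constructor
  · intro h
    constructor
    · rintro ⟨-, x, hx⟩
      exact h x (isPeriodicPt_iff_minimalPeriod_dvd.2 (hx ▸ one_dvd 2))
    · rintro ⟨-, x, hx⟩
      exact h x (isPeriodicPt_iff_minimalPeriod_dvd.2 (hx ▸ dvd_rfl))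
  · rintro ⟨h1, h2⟩ x hx
    have hd : minimalPeriod f x ∣ 2 := IsPeriodicPt.minimalPeriod_dvd (n := 2) hx
    rcases (Nat.dvd_prime Nat.prime_two).1 hd with h | h
    · exact h1 ⟨one_pos, x, h⟩
    · exact h2 ⟨two_pos, x, h⟩

/-- Agreement is asked only along orbits of periodic points of `g`, because a redefined map may
differ from `f` elsewhere. -/
theorem periods_subset_of_iterate_eq {α β : Type*} {f : α → α} {g : β → β} {e : β → α}
    (he : Injective e) (h : ∀ y ∈ periodicPts g, ∀ j, e (g^[j] y) = f^[j] (e y)) :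
    periods g ⊆ periods f := by
  rintro n ⟨hn, y, rfl⟩
  refine ⟨hn, e y, ?_⟩
  rw [minimalPeriod_eq_minimalPeriod_iff]
  intro m
  have := h y (minimalPeriod_pos_iff_mem_periodicPts.1 hn) m
  unfold IsPeriodicPt IsFixedPt
  rw [← this, he.eq_iff]

/-- A self-map of `α` can be replaced, on a nonempty subset `W`, by a self-map of `W` that agrees
with it wherever possible, and has no cycles besides the old ones, or only one fixed point. -/
theorem exists_restrict_periods {α : Type*} (f : α → α) (W : Set α) (hW : W.Nonempty) :
    ∃ g : W → W, (∀ a : W, f a ∈ W → (g a : α) = f a) ∧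
      (periods g ⊆ periods f ∨ periods g ⊆ {1}) := by
  classical
  -- The point `c` will receive every point that `f` sends out of `W`. Either its whole orbit stays
  -- in `W`, or all orbits leave `W` and `c` is the last point before the first exit of some orbit.
  obtain ⟨c, hc⟩ : ∃ c : W, (∀ j, f^[j] c ∈ W) ∨
      f c ∉ W ∧ ∀ x : W, ∃ j, f^[j] x ∉ W := by
    by_cases h : ∃ c : W, ∀ j, f^[j] c ∈ W
    · exact h.imp fun _ => Or.inl
    · push Not at h
      obtain ⟨w, hw⟩ := hW
      have hex := h ⟨w, hw⟩
      have h0 : Nat.find hex ≠ 0 := fun h0 => by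
        have := Nat.find_spec hex
        rw [h0] at this
        exact this hw
      obtain ⟨k, hk⟩ := Nat.exists_eq_succ_of_ne_zero h0
      refine ⟨⟨f^[k] w, not_not.1 (Nat.find_min hex (m := k) (by omega))⟩, Or.inr ⟨?_, h⟩⟩
      have := Nat.find_spec hex
      rw [hk, Nat.succ_eq_add_one, iterate_succ_apply'] at this
      exact this
  let g : W → W := fun a => if h : f a ∈ W then ⟨f a, h⟩ else c
  have hg : ∀ a : W, f a ∈ W → (g a : α) = f a := fun a h => by simp [g, h]
  have hg' : ∀ a : W, f a ∉ W → g a = c := fun a h => by simp [g, h]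
  have hiter : ∀ (a : W) (j : ℕ), (∀ i < j, f (g^[i] a) ∈ W) → (g^[j] a : α) = f^[j] a := by
    intro a j
    induction j with
    | zero => simp
    | succ j ih =>
      intro h
      rw [iterate_succ_apply', iterate_succ_apply', hg _ (h j (by omega)),
        ih fun i hi => h i (by omega)]
  refine ⟨g, hg, ?_⟩
  rcases hc with hc | ⟨hc, hall⟩
  · left
    have hcj : ∀ j, (g^[j] c : α) = f^[j] c := fun j => by
      induction j with
      | zero => rfl
      | succ j ih =>
        have : f (g^[j] c) = f^[j + 1] c := by rw [ih, iterate_succ_apply']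
        rw [iterate_succ_apply', hg _ (this ▸ hc (j + 1)), this]
    refine periods_subset_of_iterate_eq Subtype.val_injective fun y hy j => hiter y j ?_
    intro i _
    -- If the cycle of `y` used a redefined value, it would pass through `c`. From `c` on, `g`
    -- follows `f` inside `W`, so `f` could not leave `W` at `g^[i] y`.
    by_contra hi
    have h1 : g (g^[i] y) = c := hg' _ hi
    have hp : g^[i] y ∈ periodicPts g := by
      obtain ⟨n, hn, h⟩ := hy
      exact ⟨n, hn, h.apply_iterate i⟩
    obtain ⟨n, hn, h⟩ := hp
    obtain ⟨m, rfl⟩ := Nat.exists_eq_succ_of_ne_zero hn.ne'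
    have h2 : g^[m] c = g^[i] y := by
      rw [← h1, ← iterate_succ_apply]
      exact h
    apply hi
    rw [← h2, hcj, ← iterate_succ_apply' f]
    exact hc _
  · right
    -- Since `f c ∉ W`, the redefinition makes `c` a fixed point. Every `g`-orbit meets a redefined
    -- value and so ends at `c`.
    have hcc : g c = c := hg' c hc
    rintro n ⟨hn, y, rfl⟩
    have hy : ∃ i, f (g^[i] y) ∉ W := by
      by_contra! hcon
      obtain ⟨j, hj⟩ := hall y
      exact hj (hiter y j (fun i _ => hcon i) ▸ (g^[j] y).2)
    obtain ⟨i, hi⟩ := hy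
    have h1 : g^[i + 1] y = c := by rw [iterate_succ_apply']; exact hg' _ hi
    have h2 := minimalPeriod_apply_iterate (minimalPeriod_pos_iff_mem_periodicPts.1 hn) (i + 1)
    rw [h1] at h2
    rw [Set.mem_singleton_iff, ← h2]
    exact minimalPeriod_eq_one_iff_isFixedPt.2 hcc

theorem periods_sumElim_subset {α β : Type*} (f : α → α) (a : α) :
    periods (Sum.elim (fun x => Sum.inl (f x)) fun _ => Sum.inl a : α ⊕ β → α ⊕ β) ⊆
      periods f := by
  set g : α ⊕ β → α ⊕ β := Sum.elim (fun x => Sum.inl (f x)) fun _ => Sum.inl a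
  have hg : ∀ x j, g^[j] (Sum.inl x) = Sum.inl (f^[j] x) := fun x j => by
    induction j with
    | zero => rfl
    | succ j ih => rw [iterate_succ_apply', ih, iterate_succ_apply']; rfl
  rintro n ⟨hn, y, rfl⟩
  -- One step leads into the old part, and a periodic point has the same period as its image.
  obtain ⟨x, hx⟩ : ∃ x, g y = Sum.inl x := by
    cases y
    · exact ⟨_, rfl⟩
    · exact ⟨_, rfl⟩
  refine ⟨hn, x, ?_⟩
  have h := minimalPeriod_apply (minimalPeriod_pos_iff_mem_periodicPts.1 hn)
  rw [← h, hx, minimalPeriod_eq_minimalPeriod_iff]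
  intro m
  unfold IsPeriodicPt IsFixedPt
  rw [hg, Sum.inl_injective.eq_iff]

/-- The disjoint union of a cycle of length `m` and a cycle of length `n`. -/
def twoCycles (m n : ℕ) : ULift.{u} (ZMod m ⊕ ZMod n) → ULift.{u} (ZMod m ⊕ ZMod n) :=
  fun x => ⟨Sum.map (· + 1) (· + 1) x.down⟩

theorem minimalPeriod_twoCycles_inl (m n : ℕ) (a : ZMod m) :
    minimalPeriod (twoCycles.{u} m n) ⟨Sum.inl a⟩ = m := by
  have h : ∀ j, (twoCycles.{u} m n)^[j] ⟨Sum.inl a⟩ = ⟨Sum.inl (a + j)⟩ := fun j => by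
    induction j with
    | zero => simp
    | succ j ih => rw [iterate_succ_apply', ih]; simp [twoCycles, add_assoc]
  -- Two numbers with the same multiples are equal. This also covers `m = 0`, where `ZMod 0` is `ℤ`
  -- and nothing is periodic.
  apply Nat.dvd_right_iff_eq.1
  intro j
  rw [← isPeriodicPt_iff_minimalPeriod_dvd, IsPeriodicPt, IsFixedPt, h,
    ← ZMod.natCast_eq_zero_iff]
  simp

theorem minimalPeriod_twoCycles_inr (m n : ℕ) (a : ZMod n) :
    minimalPeriod (twoCycles.{u} m n) ⟨Sum.inr a⟩ = n := by
  have h : ∀ j, (twoCycles.{u} m n)^[j] ⟨Sum.inr a⟩ = ⟨Sum.inr (a + j)⟩ := fun j => by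
    induction j with
    | zero => simp
    | succ j ih => rw [iterate_succ_apply', ih]; simp [twoCycles, add_assoc]
  apply Nat.dvd_right_iff_eq.1
  intro j
  rw [← isPeriodicPt_iff_minimalPeriod_dvd, IsPeriodicPt, IsFixedPt, h,
    ← ZMod.natCast_eq_zero_iff]
  simp

theorem periods_twoCycles_subset (m n : ℕ) : periods (twoCycles.{u} m n) ⊆ {m, n} := by
  rintro k ⟨-, ⟨x | x⟩, rfl⟩
  · exact Or.inl (minimalPeriod_twoCycles_inl m n x)
  · exact Or.inr (minimalPeriod_twoCycles_inr m n x)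

theorem mk_twoCycles {m n : ℕ} (hm : 0 < m) (hn : 0 < n) :
    Cardinal.mk (ULift.{u} (ZMod m ⊕ ZMod n)) = (m + n : ℕ) := by
  have : NeZero m := ⟨hm.ne'⟩
  have : NeZero n := ⟨hn.ne'⟩
  simp [Cardinal.mk_fintype, ZMod.card]

/-- Cycles of different lengths are disjoint. -/
theorem add_le_mk_of_minimalPeriod {α : Type u} {f : α → α} {x y : α} {m n : ℕ} (hm : 0 < m)
    (hn : 0 < n) (hx : minimalPeriod f x = m) (hy : minimalPeriod f y = n) (hmn : m ≠ n) :
    ((m + n : ℕ) : Cardinal.{u}) ≤ Cardinal.mk α := by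
  have hpx : x ∈ periodicPts f := minimalPeriod_pos_iff_mem_periodicPts.1 (hx ▸ hm)
  have hpy : y ∈ periodicPts f := minimalPeriod_pos_iff_mem_periodicPts.1 (hy ▸ hn)
  have hinj : Injective (Sum.elim (fun i => f^[i.1] x) (fun i => f^[i.1] y) :
      Fin m ⊕ Fin n → α) := by
    refine Injective.sumElim ?_ ?_ ?_
    · intro i j h
      exact Fin.ext (iterate_injOn_Iio_minimalPeriod (f := f) (x := x)
        (Set.mem_Iio.2 (hx ▸ i.2)) (Set.mem_Iio.2 (hx ▸ j.2)) h)
    · intro i j h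
      exact Fin.ext (iterate_injOn_Iio_minimalPeriod (f := f) (x := y)
        (Set.mem_Iio.2 (hy ▸ i.2)) (Set.mem_Iio.2 (hy ▸ j.2)) h)
    · intro i j h
      -- A common point would force both cycles to have the same length.
      apply hmn
      have h' := congrArg (minimalPeriod f) h
      rwa [minimalPeriod_apply_iterate hpx, minimalPeriod_apply_iterate hpy, hx, hy] at h'
  have := Cardinal.lift_mk_le_lift_mk_of_injective hinj
  simpa using this

namespace ManySorted

/-! ### Interpretations of a unary function symbol -/

/-- The interpretation of the function symbol. -/
def Interp.func (A : Interp.{u} sigF) (a : A.Dom ()) : A.Dom () := A.fn () fun _ => a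

/-- The interpretation given by a self-map and the values of the variables. -/
def Interp.ofMap {D : Type u} (g : D → D) (v : ℕ → D) : Interp.{u} sigF where
  Dom _ := D
  dom_nonempty _ := ⟨v 0⟩
  fn _ args := g (args ⟨0, Nat.one_pos⟩)
  rel P := P.elim
  val w := v w.idx

theorem eval_fpow (A : Interp.{u} sigF) (ν : ∀ v : sigF.Var, A.Dom v.sort) (i k : ℕ) :
    (fpow i k).eval A.toStruct ν = A.func^[k] (ν ⟨(), i⟩) := by
  induction k with
  | zero => rfl
  | succ k ih => rw [iterate_succ_apply', ← ih]; rfl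

theorem code_fpow_zero (i : ℕ) : (fpow i 0).code = Nat.pair 0 (Nat.pair 0 i) := by
  simp [fpow, xvar, Term.code]

theorem code_fpow_succ (i k : ℕ) :
    (fpow i (k + 1)).code = Nat.pair 1 (Nat.pair 0 (Nat.pair (fpow i k).code 0 + 1)) := by
  simp [fpow, Term.code]

/-- This makes the code of a formula a computable bound on its variable indices and on the exponents
of `f`, so that the witness need not parse the formula. -/
theorem le_code_fpow (i k : ℕ) : i ≤ (fpow i k).code ∧ k ≤ (fpow i k).code := by
  induction k with
  | zero =>
    rw [code_fpow_zero]
    exact ⟨(Nat.right_le_pair 0 i).trans (Nat.right_le_pair 0 _), Nat.zero_le _⟩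
  | succ k ih =>
    rw [code_fpow_succ]
    have h1 := Nat.left_le_pair (fpow i k).code 0
    have h2 := Nat.right_le_pair 0 (Nat.pair (fpow i k).code 0 + 1)
    have h3 := Nat.right_le_pair 1 (Nat.pair 0 (Nat.pair (fpow i k).code 0 + 1))
    omega

theorem exists_eq_fpow : ∀ {s : Unit} (t : Term sigF s), ∃ i k, t = fpow i k
  | _, .var _ n => ⟨n, 0, rfl⟩
  | _, .app _ args => by
    obtain ⟨i, k, h⟩ := exists_eq_fpow (args ⟨0, Nat.one_pos⟩)
    refine ⟨i, k + 1, ?_⟩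
    have : args = fun _ => fpow i k := by
      funext j
      have hj : j = ⟨0, Nat.one_pos⟩ := Fin.ext (Nat.lt_one_iff.1 j.2)
      subst hj
      exact h
    rw [this]
    rfl

theorem code_le_code_eq (s : Unit) (t t' : Term sigF s) :
    t.code ≤ (Formula.eq (Sg := sigF) s t t').code ∧
      t'.code ≤ (Formula.eq (Sg := sigF) s t t').code := by
  have h0 := Nat.right_le_pair 1 (Nat.pair (Encodable.encode s) (Nat.pair t.code t'.code))
  have h1 := Nat.right_le_pair (Encodable.encode s) (Nat.pair t.code t'.code)
  exact ⟨(Nat.left_le_pair _ _).trans (h1.trans h0), (Nat.right_le_pair _ _).trans (h1.trans h0)⟩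

/-- A quantifier-free formula of code at most `c` mentions only the values of `f^k (x_i)` for
`i, k ≤ c`. -/
theorem sat_iff_of_iterate_eq {A B : Interp.{u} sigF} {μ : ∀ v : sigF.Var, A.Dom v.sort}
    {ν : ∀ v : sigF.Var, B.Dom v.sort} {e : A.Dom () → B.Dom ()} (he : Injective e) (φ : Formula sigF)
    (hφ : φ.IsQF)
    (h : ∀ i k, i ≤ φ.code → k ≤ φ.code →
      e (A.func^[k] (μ ⟨(), i⟩)) = B.func^[k] (ν ⟨(), i⟩)) :
    φ.Sat A.toStruct μ ↔ φ.Sat B.toStruct ν := by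
  induction φ with
  | fal => rfl
  | eq s t t' =>
    obtain ⟨i, k, rfl⟩ := exists_eq_fpow t
    obtain ⟨i', k', rfl⟩ := exists_eq_fpow t'
    obtain ⟨h1, h2⟩ := code_le_code_eq s (fpow i k) (fpow i' k')
    have h3 := le_code_fpow i k
    have h4 := le_code_fpow i' k'
    have e1 := h i k (h3.1.trans h1) (h3.2.trans h1)
    have e2 := h i' k' (h4.1.trans h2) (h4.2.trans h2)
    change (fpow i k).eval A.toStruct μ = (fpow i' k').eval A.toStruct μ ↔
      (fpow i k).eval B.toStruct ν = (fpow i' k').eval B.toStruct ν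
    rw [eval_fpow, eval_fpow, eval_fpow, eval_fpow, ← e1, ← e2, he.eq_iff]
  | rel P => exact P.elim
  | not φ ih =>
    have h1 := Nat.right_le_pair 3 φ.code
    exact not_congr (ih hφ fun i k hi hk => h i k (hi.trans h1) (hk.trans h1))
  | and φ ψ ih ih' =>
    have h1 := Nat.right_le_pair 4 (Nat.pair φ.code ψ.code)
    have h2 := (Nat.left_le_pair φ.code ψ.code).trans h1
    have h3 := (Nat.right_le_pair φ.code ψ.code).trans h1
    exact and_congr (ih hφ.1 fun i k hi hk => h i k (hi.trans h2) (hk.trans h2))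
      (ih' hφ.2 fun i k hi hk => h i k (hi.trans h3) (hk.trans h3))
  | or φ ψ ih ih' =>
    have h1 := Nat.right_le_pair 5 (Nat.pair φ.code ψ.code)
    have h2 := (Nat.left_le_pair φ.code ψ.code).trans h1
    have h3 := (Nat.right_le_pair φ.code ψ.code).trans h1
    exact or_congr (ih hφ.1 fun i k hi hk => h i k (hi.trans h2) (hk.trans h2))
      (ih' hφ.2 fun i k hi hk => h i k (hi.trans h3) (hk.trans h3))
  | imp φ ψ ih ih' =>
    have h1 := Nat.right_le_pair 6 (Nat.pair φ.code ψ.code)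
    have h2 := (Nat.left_le_pair φ.code ψ.code).trans h1
    have h3 := (Nat.right_le_pair φ.code ψ.code).trans h1
    exact imp_congr (ih hφ.1 fun i k hi hk => h i k (hi.trans h2) (hk.trans h2))
      (ih' hφ.2 fun i k hi hk => h i k (hi.trans h3) (hk.trans h3))
  | all => exact hφ.elim
  | ex => exact hφ.elim

theorem idx_le_code_of_mem_vars (φ : Formula sigF) (hφ : φ.IsQF) (v : sigF.Var)
    (hv : v ∈ φ.vars) : v.idx ≤ φ.code := by
  classical
  induction φ with
  | fal => simp [Formula.vars] at hv
  | eq s t t' =>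
    obtain ⟨i, k, rfl⟩ := exists_eq_fpow t
    obtain ⟨i', k', rfl⟩ := exists_eq_fpow t'
    obtain ⟨h1, h2⟩ := code_le_code_eq s (fpow i k) (fpow i' k')
    have h3 := le_code_fpow i k
    have h4 := le_code_fpow i' k'
    change v ∈ (fpow i k).vars ∪ (fpow i' k').vars at hv
    rw [fpow_vars, fpow_vars, Finset.mem_union, Finset.mem_singleton, Finset.mem_singleton] at hv
    change v.idx ≤ (Formula.eq (Sg := sigF) () (fpow i k) (fpow i' k')).code
    exact hv.elim (fun h => h ▸ h3.1.trans h1) (fun h => h ▸ h4.1.trans h2)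
  | rel P => exact P.elim
  | not φ ih => exact (ih hφ hv).trans (Nat.right_le_pair 3 φ.code)
  | and φ ψ ih ih' =>
    have h1 := Nat.right_le_pair 4 (Nat.pair φ.code ψ.code)
    exact (Finset.mem_union.1 hv).elim
      (fun hv => (ih hφ.1 hv).trans ((Nat.left_le_pair φ.code ψ.code).trans h1))
      (fun hv => (ih' hφ.2 hv).trans ((Nat.right_le_pair φ.code ψ.code).trans h1))
  | or φ ψ ih ih' =>
    have h1 := Nat.right_le_pair 5 (Nat.pair φ.code ψ.code)
    exact (Finset.mem_union.1 hv).elim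
      (fun hv => (ih hφ.1 hv).trans ((Nat.left_le_pair φ.code ψ.code).trans h1))
      (fun hv => (ih' hφ.2 hv).trans ((Nat.right_le_pair φ.code ψ.code).trans h1))
  | imp φ ψ ih ih' =>
    have h1 := Nat.right_le_pair 6 (Nat.pair φ.code ψ.code)
    exact (Finset.mem_union.1 hv).elim
      (fun hv => (ih hφ.1 hv).trans ((Nat.left_le_pair φ.code ψ.code).trans h1))
      (fun hv => (ih' hφ.2 hv).trans ((Nat.right_le_pair φ.code ψ.code).trans h1))
  | all => exact hφ.elim
  | ex => exact hφ.elim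

/-! ### Substitution of assignments, iterated quantifiers and arrangements -/

section General

variable {Sg : Signature}

theorem Term.eval_congr (M : Struct.{u} Sg) {μ ν : ∀ v : Sg.Var, M.Dom v.sort} {s : Sg.Sorts}
    (t : Term Sg s) (h : ∀ v ∈ t.vars, μ v = ν v) : t.eval M μ = t.eval M ν := by
  classical
  induction t with
  | var s n => exact h _ (Finset.mem_singleton_self _)
  | app f args ih =>
    exact congrArg (M.fn f) (funext fun i => ih i fun v hv =>
      h v (Finset.mem_biUnion.2 ⟨i, Finset.mem_univ _, hv⟩))

theorem Formula.sat_congr (M : Struct.{u} Sg) (φ : Formula Sg) {μ ν : ∀ v : Sg.Var, M.Dom v.sort}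
    (h : ∀ v ∈ φ.vars, μ v = ν v) : φ.Sat M μ ↔ φ.Sat M ν := by
  classical
  induction φ generalizing μ ν with
  | fal => rfl
  | eq s t t' =>
    simp only [Formula.Sat]
    rw [t.eval_congr M fun v hv => h v (Finset.mem_union_left _ hv),
      t'.eval_congr M fun v hv => h v (Finset.mem_union_right _ hv)]
  | rel P args =>
    simp only [Formula.Sat]
    have : (fun i => (args i).eval M μ) = fun i => (args i).eval M ν :=
      funext fun i => (args i).eval_congr M fun v hv =>
        h v (Finset.mem_biUnion.2 ⟨i, Finset.mem_univ _, hv⟩)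
    rw [this]
  | not φ ih => exact not_congr (ih h)
  | and φ ψ ih ih' =>
    exact and_congr (ih fun v hv => h v (Finset.mem_union_left _ hv))
      (ih' fun v hv => h v (Finset.mem_union_right _ hv))
  | or φ ψ ih ih' =>
    exact or_congr (ih fun v hv => h v (Finset.mem_union_left _ hv))
      (ih' fun v hv => h v (Finset.mem_union_right _ hv))
  | imp φ ψ ih ih' =>
    exact imp_congr (ih fun v hv => h v (Finset.mem_union_left _ hv))
      (ih' fun v hv => h v (Finset.mem_union_right _ hv))
  | all w φ ih =>
    refine forall_congr' fun a => ih fun v hv => ?_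
    by_cases hw : v = w
    · subst hw; simp
    · simp only [update_of_ne hw]
      exact h v (Finset.mem_erase.2 ⟨hw, hv⟩)
  | ex w φ ih =>
    refine exists_congr fun a => ih fun v hv => ?_
    by_cases hw : v = w
    · subst hw; simp
    · simp only [update_of_ne hw]
      exact h v (Finset.mem_erase.2 ⟨hw, hv⟩)

theorem Formula.sat_exs (M : Struct.{u} Sg) (l : List Sg.Var) (φ : Formula Sg)
    (ν : ∀ v : Sg.Var, M.Dom v.sort) :
    (Formula.exs l φ).Sat M ν ↔
      ∃ μ : ∀ v : Sg.Var, M.Dom v.sort, (∀ v ∉ l, μ v = ν v) ∧ φ.Sat M μ := by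
  classical
  induction l generalizing ν with
  | nil =>
    constructor
    · exact fun h => ⟨ν, fun _ _ => rfl, h⟩
    · rintro ⟨μ, h, hμ⟩
      exact (funext fun v => h v List.not_mem_nil : μ = ν) ▸ hμ
  | cons w l ih =>
    change (∃ a, (Formula.exs l φ).Sat M _) ↔ _
    simp only [ih]
    constructor
    · rintro ⟨a, μ, h, hμ⟩
      refine ⟨μ, fun v hv => ?_, hμ⟩
      rw [List.mem_cons, not_or] at hv
      rw [h v hv.2, update_of_ne hv.1]
    · rintro ⟨μ, h, hμ⟩
      refine ⟨μ w, μ, fun v hv => ?_, hμ⟩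
      by_cases hw : v = w
      · subst hw; simp
      · rw [update_of_ne hw]
        exact h v (by simp [hw, hv])

theorem Formula.sat_conj (M : Struct.{u} Sg) (l : List (Formula Sg))
    (ν : ∀ v : Sg.Var, M.Dom v.sort) : (Formula.conj l).Sat M ν ↔ ∀ φ ∈ l, φ.Sat M ν := by
  induction l with
  | nil => simp [Formula.conj, Formula.Sat]
  | cons φ l ih =>
    rw [List.forall_mem_cons, ← ih]
    rfl

theorem Formula.subset_vars_conj {l : List (Formula Sg)} {φ : Formula Sg} (h : φ ∈ l) :
    φ.vars ⊆ (Formula.conj l).vars := by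
  classical
  induction l with
  | nil => exact absurd h List.not_mem_nil
  | cons ψ l ih =>
    change φ.vars ⊆ ψ.vars ∪ (Formula.conj l).vars
    rcases List.mem_cons.1 h with rfl | h
    · exact fun v hv => Finset.mem_union_left _ hv
    · exact fun v hv => Finset.mem_union_right _ (ih h hv)

open Classical in
-- The diagonal pair `(v, v)` contributes the equation `v = v`, in which `v` occurs.
theorem subset_vars_arrangement (V : Finset Sg.Var) (E : Setoid Sg.Var) :
    V ⊆ (arrangement V E).vars := by
  intro v hv
  refine Formula.subset_vars_conj (List.mem_map.2 ⟨(v, v), ?_, rfl⟩) ?_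
  · simp [hv]
  · rw [if_pos (E.refl v)]
    exact Finset.mem_union_left _ (Finset.mem_singleton_self v)

theorem sat_arrangement_sigF (A : Interp.{u} sigF) (V : Finset sigF.Var) (E : Setoid sigF.Var) :
    A.Models (arrangement V E) ↔
      ∀ x ∈ V, ∀ y ∈ V, E x y ↔ A.val ⟨(), x.idx⟩ = A.val ⟨(), y.idx⟩ := by
  classical
  unfold Interp.Models arrangement
  rw [Formula.sat_conj, List.forall_mem_map]
  constructor
  · intro h x hx y hy
    have := h (x, y) (by simp [hx, hy])
    split_ifs at this with hE
    · exact ⟨fun _ => this, fun _ => hE⟩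
    · exact ⟨fun h => absurd h hE, fun h => absurd h this⟩
  · rintro h ⟨x, y⟩ hxy
    simp only [Finset.mem_toList, Finset.mem_filter, Finset.mem_product] at hxy
    have := h x hxy.1.1 y hxy.1.2
    split_ifs with hE
    · exact this.1 hE
    · exact fun h => hE (this.2 h)

end General

/-! ### Theories that restrict the lengths of cycles -/

theorem sat_cycle (A : Interp.{u} sigF) (ν : ∀ v : sigF.Var, A.Dom v.sort) (i : ℕ) {n : ℕ}
    (hn : 0 < n) :
    (cycle n i).Sat A.toStruct ν ↔ minimalPeriod A.func (ν ⟨(), i⟩) = n := by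
  rw [← forall_properDivisors_ne_iff_minimalPeriod_eq hn]
  change (fpow i n).eval A.toStruct ν = (fpow i 0).eval A.toStruct ν ∧
    (Formula.conj _).Sat A.toStruct ν ↔ _
  rw [Formula.sat_conj, List.forall_mem_map, eval_fpow, eval_fpow]
  refine and_congr Iff.rfl (forall_congr' fun m => ?_)
  rw [Finset.mem_toList]
  refine imp_congr_right fun _ => ?_
  change ¬ ((fpow i m).eval A.toStruct ν = (fpow i 0).eval A.toStruct ν) ↔ _
  rw [eval_fpow, eval_fpow]
  rfl

theorem sat_ex_cycle (A : Interp.{u} sigF) {n : ℕ} (hn : 0 < n) :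
    A.Models (.ex ⟨(), 0⟩ (cycle n 0)) ↔ n ∈ periods A.func := by
  classical
  rw [mem_periods, and_iff_right hn]
  refine exists_congr fun a => ?_
  rw [sat_cycle _ _ _ hn, update_self]

theorem models_cycleAxiom (A : Interp.{u} sigF) {n : ℕ} (hn : 0 < n) :
    A.Models (cycleAxiom n) ↔
      (n ∈ periods A.func → 1 ∉ periods A.func ∧ 2 ∉ periods A.func) := by
  classical
  rw [← sat_ex_cycle A hn, ← forall_iterate_two_ne_iff_periods]
  refine imp_congr_right fun _ => forall_congr' fun a => ?_
  change ¬ ((fpow 0 2).eval A.toStruct _ = (fpow 0 0).eval A.toStruct _) ↔ _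
  rw [eval_fpow, eval_fpow, update_self]
  rfl

/-- `T` is axiomatized by a condition on the set of lengths of the cycles that is inherited by
subsets, and forbids a cycle of length `n ≥ 7` next to a fixed point if and only if `n ∈ S`. -/
structure IsPeriodTheory (T : Theory sigF) (S : Set ℕ) (Q : Set ℕ → Prop) : Prop where
  isInterp_iff : ∀ A : Interp.{u} sigF, T.IsInterp A ↔ Q (periods A.func)
  mono : ∀ {P P' : Set ℕ}, P ⊆ P' → Q P' → Q P
  one : Q {1}
  three : ∀ n, 7 ≤ n → Q {n, 3}
  not_mem : ∀ n, 7 ≤ n → n ∉ S → Q {n, 1}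
  mem : ∀ n ∈ S, ∀ P, n ∈ P → 1 ∈ P → ¬ Q P

/-- The bound `7` keeps the length `1` out of `S`, so that a lone fixed point triggers no axiom. The
set `{n, 3}` avoids `1` and `2`, so it is allowed whether or not `n ∈ S`. -/
theorem isPeriodTheory_T₁ {S : Set ℕ} (hS : ∀ p ∈ S, 7 ≤ p) :
    IsPeriodTheory.{u} (T₁ S) S fun P => ∀ n ∈ S, n ∈ P → 1 ∉ P ∧ 2 ∉ P where
  isInterp_iff A := by
    constructor
    · intro h n hn
      exact (models_cycleAxiom A (by have := hS n hn; omega)).1 (h _ ⟨n, hn, rfl⟩)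
    · rintro h _ ⟨n, hn, rfl⟩
      exact (models_cycleAxiom A (by have := hS n hn; omega)).2 (h n hn)
  mono h hP n hn hnP := (hP n hn (h hnP)).imp (mt fun h1 => h h1) (mt fun h2 => h h2)
  one n hn hn1 := by
    have := hS n hn
    rw [Set.mem_singleton_iff] at hn1
    omega
  three n hn m _ _ := by
    simp only [Set.mem_insert_iff, Set.mem_singleton_iff]
    omega
  not_mem n hn hnS m hm hmn := by
    have := hS m hm
    rcases hmn with rfl | h
    · exact absurd hm hnS
    · rw [Set.mem_singleton_iff] at h
      omega
  mem n hn P hnP h1 h := (h n hn hnP).1 h1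

theorem isPeriodTheory_T₂ {S : Set ℕ} (hS : ∀ p ∈ S, 7 ≤ p) :
    IsPeriodTheory.{u} (T₂ S) S fun P => (∀ n ∈ S, n ∈ P → 1 ∉ P ∧ 2 ∉ P) ∧ 6 ∉ P where
  isInterp_iff A := by
    rw [← (isPeriodTheory_T₁ hS).isInterp_iff A, ← sat_ex_cycle A (by norm_num : 0 < 6)]
    constructor
    · exact fun h => ⟨fun φ hφ => h φ (Or.inl hφ), h _ (Or.inr rfl)⟩
    · rintro ⟨h, h6⟩ φ (hφ | rfl)
      · exact h φ hφ
      · exact h6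
  mono h hP := ⟨(isPeriodTheory_T₁.{u} hS).mono h hP.1, mt (fun h6 => h h6) hP.2⟩
  one := ⟨(isPeriodTheory_T₁.{u} hS).one, by simp⟩
  three n hn := ⟨(isPeriodTheory_T₁.{u} hS).three n hn, by
    simp only [Set.mem_insert_iff, Set.mem_singleton_iff]; omega⟩
  not_mem n hn h := ⟨(isPeriodTheory_T₁.{u} hS).not_mem n hn h, by
    simp only [Set.mem_insert_iff, Set.mem_singleton_iff]; omega⟩
  mem n hn P hnP h1 h := (isPeriodTheory_T₁.{u} hS).mem n hn P hnP h1 h.1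

theorem IsPeriodTheory.smooth {T : Theory sigF} {S : Set ℕ} {Q : Set ℕ → Prop}
    (hT : IsPeriodTheory.{u} T S Q) : T.Smooth.{u} {()} := by
  intro φ A hA hφ κ hκ
  -- `C` supplies the missing points. They are all mapped to the old point `a`, and the variables
  -- keep their old values.
  obtain ⟨c, hc⟩ := le_iff_exists_add.1 (hκ ⟨(), rfl⟩)
  induction c using Cardinal.inductionOn with | _ C
  let a : A.Dom () := A.val ⟨(), 0⟩
  let B : Interp.{u} sigF := Interp.ofMap (D := A.Dom () ⊕ C)
    (Sum.elim (fun x => Sum.inl (A.func x)) fun _ => Sum.inl a) fun i => Sum.inl (A.val ⟨(), i⟩)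
  refine ⟨B, ?_, ?_, ?_⟩
  · exact (hT.isInterp_iff B).2
      (hT.mono (periods_sumElim_subset A.func a) ((hT.isInterp_iff A).1 hA))
  · refine (sat_iff_of_iterate_eq (A := A) (B := B) (e := Sum.inl) Sum.inl_injective φ.1 φ.2
      fun i k _ _ => ?_).1 hφ
    induction k with
    | zero => rfl
    | succ k ih =>
      rw [iterate_succ_apply', iterate_succ_apply', ← ih (by omega)]
      rfl
  · rintro ⟨⟨⟩, h⟩
    exact (Cardinal.add_def (A.Dom ()) C).symm.trans hc.symm

theorem Theory.Smooth.stablyInfinite {Sg : Signature} {T : Theory Sg} {R : Set Sg.Sorts}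
    (h : T.Smooth.{u} R) : T.StablyInfinite.{u} R := by
  rintro φ ⟨A, hA, hφ⟩
  obtain ⟨B, hB, hBφ, hc⟩ := h φ A hA hφ
    (fun s => max (Cardinal.mk (A.Dom s)) Cardinal.aleph0) fun s => le_max_left _ _
  exact ⟨B, hB, hBφ, fun s hs => (hc ⟨s, hs⟩).symm ▸ le_max_right _ _⟩

/-! ### A formula whose minimal models reveal `S` -/

/-- The formula `f x₀ ≠ x₀ ∧ … ∧ f^k x₀ ≠ x₀`. -/
def noReturn : ℕ → Formula sigF
  | 0 => .not .fal
  | k + 1 => .and (noReturn k) (.not (.eq () (fpow 0 (k + 1)) (fpow 0 0)))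

/-- `x₀` is on a cycle of length `n + 1`, and `f^k x₁ = x₁`. -/
def periodTest (n k : ℕ) : Formula sigF :=
  .and (.and (.eq () (fpow 0 (n + 1)) (fpow 0 0)) (noReturn n)) (.eq () (fpow 1 k) (fpow 1 0))

theorem isQF_noReturn (k : ℕ) : (noReturn k).IsQF := by
  induction k with
  | zero => trivial
  | succ k ih => exact ⟨ih, trivial⟩

theorem isQF_periodTest (n k : ℕ) : (periodTest n k).IsQF :=
  ⟨⟨trivial, isQF_noReturn n⟩, trivial⟩

theorem models_periodTest (A : Interp.{u} sigF) (n k : ℕ) :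
    A.Models (periodTest n k) ↔ minimalPeriod A.func (A.val ⟨(), 0⟩) = n + 1 ∧
      minimalPeriod A.func (A.val ⟨(), 1⟩) ∣ k := by
  have hno : A.Models (noReturn n) ↔
      ∀ m, 0 < m → m < n + 1 → A.func^[m] (A.val ⟨(), 0⟩) ≠ A.val ⟨(), 0⟩ := by
    induction n with
    | zero =>
      constructor
      · intro _ m h0 h1
        omega
      · exact fun _ h => h
    | succ n ih =>
      change A.Models (noReturn n) ∧ ¬ ((fpow 0 (n + 1)).eval A.toStruct A.val =
        (fpow 0 0).eval A.toStruct A.val) ↔ _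
      rw [ih, eval_fpow, eval_fpow]
      constructor
      · rintro ⟨h, h'⟩ m h0 h1
        rcases Nat.lt_succ_iff_lt_or_eq.1 h1 with h2 | rfl
        · exact h m h0 h2
        · exact h'
      · exact fun h => ⟨fun m h0 h1 => h m h0 (by omega), h (n + 1) (by omega) (by omega)⟩
  rw [← forall_lt_ne_iff_minimalPeriod_eq n.succ_pos, ← isPeriodicPt_iff_minimalPeriod_dvd, ← hno]
  change ((fpow 0 (n + 1)).eval A.toStruct A.val = (fpow 0 0).eval A.toStruct A.val ∧
    A.Models (noReturn n)) ∧
    (fpow 1 k).eval A.toStruct A.val = (fpow 1 0).eval A.toStruct A.val ↔ _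
  simp only [eval_fpow]
  rfl

/-- The model consisting of a cycle of length `n + 1` and a cycle of length `k`. -/
def twoCycleModel (n k : ℕ) : Interp.{u} sigF :=
  Interp.ofMap (twoCycles.{u} (n + 1) k) fun i => ⟨if i = 0 then Sum.inl 0 else Sum.inr 0⟩

theorem models_twoCycleModel (n : ℕ) {j k : ℕ} (h : j ∣ k) :
    (twoCycleModel.{u} n j).Models (periodTest n k) := by
  rw [models_periodTest]
  exact ⟨minimalPeriod_twoCycles_inl.{u} _ _ _,
    (minimalPeriod_twoCycles_inr.{u} (n + 1) j 0).symm ▸ h⟩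

theorem mk_twoCycleModel (n : ℕ) {k : ℕ} (hk : 0 < k) :
    Cardinal.mk ((twoCycleModel.{u} n k).Dom ()) = (n + 1 + k : ℕ) :=
  mk_twoCycles n.succ_pos hk

theorem primrec_code_fpow : Primrec₂ fun i k => (fpow i k).code := by
  have h : Primrec₂ fun i k => (Nat.rec (Nat.pair 0 (Nat.pair 0 i))
      (fun _ c => Nat.pair 1 (Nat.pair 0 (Nat.pair c 0 + 1))) k : ℕ) := by
    refine Primrec.nat_rec (f := fun i => Nat.pair 0 (Nat.pair 0 i))
      (g := fun (_ : ℕ) (p : ℕ × ℕ) => Nat.pair 1 (Nat.pair 0 (Nat.pair p.2 0 + 1))) ?_ ?_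
    · exact Primrec₂.natPair.comp (Primrec.const 0)
        (Primrec₂.natPair.comp (Primrec.const 0) Primrec.id)
    · exact Primrec₂.natPair.comp (Primrec.const 1) (Primrec₂.natPair.comp (Primrec.const 0)
        (Primrec.succ.comp (Primrec₂.natPair.comp (Primrec.snd.comp Primrec.snd)
          (Primrec.const 0))))
  refine h.of_eq fun i k => ?_
  induction k with
  | zero => exact (code_fpow_zero i).symm
  | succ k ih => rw [code_fpow_succ, ← ih]

theorem primrec_code_eq {α : Type*} [Primcodable α] {t t' : α → Term sigF ()}
    (ht : Primrec fun a => (t a).code) (ht' : Primrec fun a => (t' a).code) :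
    Primrec fun a => (Formula.eq (Sg := sigF) () (t a) (t' a)).code :=
  Primrec₂.natPair.comp (Primrec.const 1) (Primrec₂.natPair.comp (Primrec.const 0)
    (Primrec₂.natPair.comp ht ht'))

theorem primrec_code_noReturn : Primrec fun k => (noReturn k).code := by
  have h : Primrec fun k => (Nat.rec (Nat.pair 3 (Nat.pair 0 0))
      (fun m c => Nat.pair 4 (Nat.pair c
        (Nat.pair 3 (Formula.eq (Sg := sigF) () (fpow 0 (m + 1)) (fpow 0 0)).code))) k : ℕ) := by
    refine Primrec.nat_rec₁ _ ?_
    refine Primrec₂.natPair.comp (Primrec.const 4) (Primrec₂.natPair.comp Primrec.snd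
      (Primrec₂.natPair.comp (Primrec.const 3) (primrec_code_eq ?_ (Primrec.const _))))
    exact primrec_code_fpow.comp (Primrec.const 0) (Primrec.succ.comp Primrec.fst)
  refine h.of_eq fun k => ?_
  induction k with
  | zero => rfl
  | succ k ih =>
    change _ = Nat.pair 4 (Nat.pair (noReturn k).code _)
    rw [← ih]
    rfl

theorem primrec_code_periodTest (k : ℕ) : Primrec fun n => (periodTest n k).code :=
  Primrec₂.natPair.comp (Primrec.const 4) (Primrec₂.natPair.comp
    (Primrec₂.natPair.comp (Primrec.const 4) (Primrec₂.natPair.comp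
      (primrec_code_eq (primrec_code_fpow.comp (Primrec.const 0) Primrec.succ) (Primrec.const _))
      primrec_code_noReturn))
    (Primrec.const _))

/-- A set of numbers that are at least `7` is decidable if a computable function decides which successors belong to it. -/
theorem computablePred_of_bool {S : Set ℕ} (hS : ∀ p ∈ S, 7 ≤ p) {d : ℕ → Bool}
    (hd : Computable d) (h : ∀ n, 7 ≤ n + 1 → (d n = false ↔ n + 1 ∈ S)) :
    ComputablePred fun n : ℕ => n ∈ S := by
  -- `periodTest n` concerns the length `n + 1`, whence the shift by `Nat.pred`. The guard `7 ≤ n`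
  -- discards `0`, where the predecessor is a default value.
  have h7 : ComputablePred fun n : ℕ => 7 ≤ n :=
    (PrimrecRel.comp Primrec.nat_le (Primrec.const 7) Primrec.id).computablePred
  have hf : ComputablePred fun n : ℕ => d n.pred = false := by
    refine ⟨inferInstance, ?_⟩
    exact ((Primrec.beq.to_comp.comp (hd.comp Primrec.pred.to_comp)
      (Computable.const false)).of_eq fun n => by
        rw [Bool.eq_iff_iff, beq_iff_eq, decide_eq_true_iff])
  obtain ⟨_, h1⟩ := h7
  obtain ⟨_, h2⟩ := hf
  classical
  refine ⟨inferInstance, (Primrec.and.to_comp.comp h1 h2).of_eq fun n => ?_⟩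
  rw [Bool.eq_iff_iff, Bool.and_eq_true, decide_eq_true_iff, decide_eq_true_iff,
    decide_eq_true_iff]
  constructor
  · rintro ⟨hn, h'⟩
    obtain ⟨m, rfl⟩ := Nat.exists_eq_succ_of_ne_zero (by omega : n ≠ 0)
    exact (h m hn).1 h'
  · intro hn
    have hn7 := hS n hn
    obtain ⟨m, rfl⟩ := Nat.exists_eq_succ_of_ne_zero (by omega : n ≠ 0)
    exact ⟨hn7, (h m hn7).2 hn⟩

/-! ### Reductions from membership in `S` -/

section Undecidability

variable {T : Theory sigF} {S : Set ℕ} {Q : Set ℕ → Prop}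

theorem IsPeriodTheory.not_models_of_mem (hT : IsPeriodTheory.{u} T S Q) {n : ℕ}
    (hn : n + 1 ∈ S) {A : Interp.{u} sigF} (hA : T.IsInterp A)
    (h0 : minimalPeriod A.func (A.val ⟨(), 0⟩) = n + 1) :
    minimalPeriod A.func (A.val ⟨(), 1⟩) ≠ 1 := fun h1 =>
  hT.mem _ hn (periods A.func) ⟨n.succ_pos, _, h0⟩ ⟨one_pos, _, h1⟩ ((hT.isInterp_iff A).1 hA)

theorem IsPeriodTheory.isInterp_twoCycleModel_one (hT : IsPeriodTheory.{u} T S Q) {n : ℕ}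
    (hn : 7 ≤ n + 1) (hnS : n + 1 ∉ S) : T.IsInterp (twoCycleModel.{u} n 1) :=
  (hT.isInterp_iff _).2 (hT.mono (periods_twoCycles_subset _ _) (hT.not_mem _ hn hnS))

theorem IsPeriodTheory.isInterp_twoCycleModel_three (hT : IsPeriodTheory.{u} T S Q) {n : ℕ}
    (hn : 7 ≤ n + 1) : T.IsInterp (twoCycleModel.{u} n 3) :=
  (hT.isInterp_iff _).2 (hT.mono (periods_twoCycles_subset _ _) (hT.three _ hn))

theorem IsPeriodTheory.satisfiable_periodTest_one (hT : IsPeriodTheory.{u} T S Q) {n : ℕ}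
    (hn : 7 ≤ n + 1) : T.Satisfiable.{u} (periodTest n 1) ↔ n + 1 ∉ S := by
  constructor
  · rintro ⟨A, hA, h⟩ hnS
    rw [models_periodTest] at h
    exact hT.not_models_of_mem hnS hA h.1 (Nat.dvd_one.1 h.2)
  · exact fun hnS =>
      ⟨_, hT.isInterp_twoCycleModel_one hn hnS, models_twoCycleModel n dvd_rfl⟩

theorem IsPeriodTheory.not_isDecidable (hT : IsPeriodTheory.{u} T S Q)
    (hS : ∀ p ∈ S, 7 ≤ p) (hS' : ¬ ComputablePred fun n : ℕ => n ∈ S) :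
    ¬ T.IsDecidable.{u} := by
  rintro ⟨d, hd, h⟩
  refine hS' (computablePred_of_bool hS (hd.comp (primrec_code_periodTest 1).to_comp)
    fun n hn => ?_)
  have := (h ⟨_, isQF_periodTest n 1⟩).trans (hT.satisfiable_periodTest_one hn)
  rw [← Bool.not_eq_true, this, not_not]

/-- As `3` is prime, `x₁` has period `1` or `3`, and its cycle is disjoint from the longer one.
Membership of `n + 1` in `S` excludes period `1`. -/
theorem IsPeriodTheory.add_le_mk (hT : IsPeriodTheory.{u} T S Q) {n : ℕ} (hn : 7 ≤ n + 1)
    {A : Interp.{u} sigF} (hA : T.IsInterp A) (h : A.Models (periodTest n 3)) :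
    ((n + 1 + 1 : ℕ) : Cardinal.{u}) ≤ Cardinal.mk (A.Dom ()) ∧
      (n + 1 ∈ S → ((n + 1 + 3 : ℕ) : Cardinal.{u}) ≤ Cardinal.mk (A.Dom ())) := by
  rw [models_periodTest] at h
  rcases (Nat.dvd_prime Nat.prime_three).1 h.2 with h1 | h3
  · exact ⟨add_le_mk_of_minimalPeriod n.succ_pos one_pos h.1 h1 (by omega),
      fun hnS => absurd h1 (hT.not_models_of_mem hnS hA h.1)⟩
  · have := add_le_mk_of_minimalPeriod n.succ_pos three_pos h.1 h3 (by omega)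
    exact ⟨le_trans (Nat.cast_le.2 (by omega)) this, fun _ => this⟩

theorem toCard_eq_natCast {v : Option ℕ} {k : ℕ} :
    toCard.{u} v = (k : Cardinal.{u}) ↔ v = some k := by
  cases v with
  | none => simpa [toCard] using (Cardinal.natCast_lt_aleph0 (n := k)).ne'
  | some m => simp [toCard]

/-- Over a single sort, the cardinal condition becomes a decidable check of one row of the
algorithm's output. -/
theorem isTable_natCast_iff (row : List (Unit × Option ℕ)) (k : ℕ) :
    IsTable (Sg := sigF) (R := {()}) row (fun _ => (k : Cardinal.{u})) ↔
      (∃ e ∈ row, e.2 = some k) ∧ ∀ e ∈ row, e.2 = some k := by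
  constructor
  · intro h
    constructor
    · obtain ⟨v, hv, hk⟩ := (h ⟨(), rfl⟩ k).1 rfl
      exact ⟨_, hv, toCard_eq_natCast.1 hk⟩
    · intro e he
      exact toCard_eq_natCast.1 ((h ⟨(), rfl⟩ (toCard e.2)).2 ⟨e.2, he, rfl⟩).symm
  · rintro ⟨⟨e, he, hek⟩, h⟩ s c
    constructor
    · rintro rfl
      exact ⟨e.2, he, toCard_eq_natCast.2 hek⟩
    · rintro ⟨v, hv, rfl⟩
      exact (toCard_eq_natCast.2 (h _ hv)).symm

theorem IsPeriodTheory.mem_minimalModelFunction_iff (hT : IsPeriodTheory.{u} T S Q)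
    {MM : QF sigF → Set (({()} : Set sigF.Sorts) → Cardinal.{u})}
    (hMM : T.IsMinimalModelFunction {()} MM) {n : ℕ} (hn : 7 ≤ n + 1) :
    (fun _ => ((n + 2 : ℕ) : Cardinal.{u})) ∈ MM ⟨_, isQF_periodTest n 3⟩ ↔ n + 1 ∉ S := by
  -- The 3-cycle model makes the formula satisfiable in all cases; without this the minimal model
  -- function would be unconstrained.
  obtain ⟨h1, -, h3⟩ := hMM ⟨_, isQF_periodTest n 3⟩
    ⟨_, hT.isInterp_twoCycleModel_three hn, models_twoCycleModel n dvd_rfl⟩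
  constructor
  · intro h hnS
    obtain ⟨A, hA, hφ, hc⟩ := h1 _ h
    have := (hT.add_le_mk hn hA hφ).2 hnS
    rw [← hc ⟨(), rfl⟩, Nat.cast_le] at this
    omega
  · intro hnS
    -- Some `m ∈ MM` lies below the model of size `n + 2`. Being the size of a model, it is also at
    -- least `n + 2`.
    obtain ⟨m, hm, hle⟩ := h3 _ (hT.isInterp_twoCycleModel_one hn hnS)
      (models_twoCycleModel n (one_dvd 3))
    obtain ⟨A, hA, hφ, hc⟩ := h1 m hm
    convert hm using 1
    funext ⟨⟨⟩, hs⟩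
    refine le_antisymm ?_ ?_
    · rw [hc]
      exact (hT.add_le_mk hn hA hφ).1
    · refine (hle _).trans (le_of_eq ?_)
      exact mk_twoCycleModel n one_pos

/-- All quantifiers range over finite lists, so the test is primitive recursive in the list and the
target value. -/
theorem computable_exists_row {α β γ : Type*} [Primcodable α] [Primcodable β] [Primcodable γ]
    [DecidableEq β] {h : α → List (List (γ × β))} {b : α → β} (hh : Computable h)
    (hb : Computable b) :
    Computable fun a =>
      decide (∃ row ∈ h a, (∃ e ∈ row, e.2 = b a) ∧ ∀ e ∈ row, e.2 = b a) := by
  classical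
  have heq : PrimrecRel fun (e : γ × β) (b : β) => e.2 = b :=
    Primrec.eq.comp (Primrec.snd.comp Primrec.fst) Primrec.snd
  have hrow : PrimrecRel fun (row : List (γ × β)) (b : β) =>
      (∃ e ∈ row, e.2 = b) ∧ ∀ e ∈ row, e.2 = b :=
    PrimrecPred.and heq.exists_mem_list heq.forall_mem_list
  obtain ⟨_, hp⟩ := hrow.exists_mem_list
  exact (hp.to_comp.comp (hh.pair hb)).of_eq fun a => by congr

theorem IsPeriodTheory.not_hasComputableMMF (hT : IsPeriodTheory.{u} T S Q)
    (hS : ∀ p ∈ S, 7 ≤ p) (hS' : ¬ ComputablePred fun n : ℕ => n ∈ S) :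
    ¬ T.HasComputableMMF.{u} {()} := by
  rintro ⟨MM, hMM, h, hh, hMMh⟩
  refine hS' (computablePred_of_bool hS (computable_exists_row
    (hh.comp (primrec_code_periodTest 3).to_comp)
    (b := fun n => some (n + 2)) (Primrec.option_some.comp
      (Primrec.succ.comp Primrec.succ)).to_comp) fun n hn => ?_)
  rw [decide_eq_false_iff_not, not_iff_comm, ← hT.mem_minimalModelFunction_iff hMM hn, hMMh]
  refine exists_congr fun row => and_congr_right fun _ => ?_
  exact isTable_natCast_iff row (n + 2)

end Undecidability

/-! ### The strong witness -/

/-- The conjunction of the equations `x_{c + 1 + m} = f^j (x_i)`, where `m < k` is the code of the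
pair `(i, j)`. -/
def flattening (c : ℕ) : ℕ → Formula sigF
  | 0 => .not .fal
  | k + 1 => .and (flattening c k)
      (.eq () (fpow (c + 1 + k) 0) (fpow k.unpair.1 k.unpair.2))

/-- The formula `φ`, together with names for the values of its subterms. -/
def flatWitness (φ : QF sigF) : QF sigF :=
  ⟨.and φ.1 (flattening φ.1.code ((φ.1.code + 1) ^ 2)), φ.2, by
    induction (φ.1.code + 1) ^ 2 with
    | zero => trivial
    | succ k ih => exact ⟨ih, trivial⟩⟩

theorem sat_flattening (A : Interp.{u} sigF) (ν : ∀ v : sigF.Var, A.Dom v.sort) (c k : ℕ) :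
    (flattening c k).Sat A.toStruct ν ↔ ∀ m < k,
      ν ⟨(), c + 1 + m⟩ = A.func^[m.unpair.2] (ν ⟨(), m.unpair.1⟩) := by
  induction k with
  | zero => simp [flattening, Formula.Sat]
  | succ k ih =>
    change (flattening c k).Sat A.toStruct ν ∧
      (fpow _ 0).eval A.toStruct ν = (fpow _ _).eval A.toStruct ν ↔ _
    rw [ih, eval_fpow, eval_fpow]
    constructor
    · rintro ⟨h, h'⟩ m hm
      rcases Nat.lt_succ_iff_lt_or_eq.1 hm with h2 | rfl
      · exact h m h2
      · exact h'
    · exact fun h => ⟨fun m hm => h m (by omega), h k (by omega)⟩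

theorem mem_vars_flattening {c k m : ℕ} (hm : m < k) :
    (⟨(), c + 1 + m⟩ : sigF.Var) ∈ (flattening c k).vars ∧
      (⟨(), m.unpair.1⟩ : sigF.Var) ∈ (flattening c k).vars := by
  classical
  induction k with
  | zero => omega
  | succ k ih =>
    change _ ∈ (flattening c k).vars ∪ ((fpow _ 0).vars ∪ (fpow _ _).vars) ∧
      _ ∈ (flattening c k).vars ∪ ((fpow _ 0).vars ∪ (fpow _ _).vars)
    rcases Nat.lt_succ_iff_lt_or_eq.1 hm with h | rfl
    · exact (ih h).imp (Finset.mem_union_left _) (Finset.mem_union_left _)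
    · rw [fpow_vars, fpow_vars]
      simp

/-- `Nat.pair` fills each square `[0, c]²` before leaving it, so the codes of its pairs are exactly
the numbers below `(c + 1) ^ 2`. This explains the number of equations in `flatWitness`. -/
theorem pair_lt_sq_of_le {c i j : ℕ} (hi : i ≤ c) (hj : j ≤ c) : Nat.pair i j < (c + 1) ^ 2 :=
  (Nat.pair_lt_max_add_one_sq i j).trans_le
    (Nat.pow_le_pow_left (Nat.succ_le_succ (max_le hi hj)) 2)

theorem unpair_le_of_lt_sq {c m : ℕ} (hm : m < (c + 1) ^ 2) :
    m.unpair.1 ≤ c ∧ m.unpair.2 ≤ c := by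
  have h1 := Nat.max_sq_add_min_le_pair m.unpair.1 m.unpair.2
  rw [Nat.pair_unpair] at h1
  rw [← max_le_iff]
  by_contra h
  have h2 : (c + 1) ^ 2 ≤ max m.unpair.1 m.unpair.2 ^ 2 := Nat.pow_le_pow_left (by omega) 2
  omega

theorem mem_vars_flatWitness (φ : QF sigF) {i : ℕ} (hi : i ≤ φ.1.code) :
    (⟨(), i⟩ : sigF.Var) ∈ (flatWitness φ).1.vars := by
  classical
  have h := (mem_vars_flattening (c := φ.1.code) (pair_lt_sq_of_le hi (Nat.zero_le φ.1.code))).2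
  rw [Nat.unpair_pair] at h
  exact Finset.mem_union_right _ h

theorem mem_vars_flatWitness_pair (φ : QF sigF) {i j : ℕ} (hi : i ≤ φ.1.code)
    (hj : j ≤ φ.1.code) :
    (⟨(), φ.1.code + 1 + Nat.pair i j⟩ : sigF.Var) ∈ (flatWitness φ).1.vars := by
  classical
  exact Finset.mem_union_right _ (mem_vars_flattening (pair_lt_sq_of_le hi hj)).1

theorem exists_computable_flatWitness :
    ∃ h : ℕ → ℕ, Computable h ∧ ∀ φ : QF sigF, h φ.1.code = (flatWitness φ).1.code := by
  have h : Primrec₂ fun c k => (flattening c k).code := by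
    have h : Primrec₂ fun c k => (Nat.rec (Nat.pair 3 (Nat.pair 0 0))
        (fun m d => Nat.pair 4 (Nat.pair d (Formula.eq (Sg := sigF) ()
          (fpow (c + 1 + m) 0) (fpow m.unpair.1 m.unpair.2)).code)) k : ℕ) := by
      refine Primrec.nat_rec (f := fun _ => Nat.pair 3 (Nat.pair 0 0))
        (g := fun (c : ℕ) (p : ℕ × ℕ) => Nat.pair 4 (Nat.pair p.2 (Formula.eq (Sg := sigF) ()
          (fpow (c + 1 + p.1) 0) (fpow p.1.unpair.1 p.1.unpair.2)).code)) (Primrec.const _) ?_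
      refine Primrec₂.natPair.comp (Primrec.const 4) (Primrec₂.natPair.comp
        (Primrec.snd.comp Primrec.snd) (primrec_code_eq ?_ ?_))
      · exact primrec_code_fpow.comp (Primrec.nat_add.comp (Primrec.succ.comp Primrec.fst)
          (Primrec.fst.comp Primrec.snd)) (Primrec.const 0)
      · have hu := Primrec.unpair.comp (Primrec.fst.comp (Primrec.snd (α := ℕ) (β := ℕ × ℕ)))
        exact primrec_code_fpow.comp (Primrec.fst.comp hu) (Primrec.snd.comp hu)
    refine h.of_eq fun c k => ?_
    induction k with
    | zero => rfl
    | succ k ih =>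
      change _ = Nat.pair 4 (Nat.pair (flattening c k).code _)
      rw [← ih]
  refine ⟨fun c => Nat.pair 4 (Nat.pair c (flattening c ((c + 1) ^ 2)).code), ?_, fun φ => rfl⟩
  have hsq : Primrec fun c : ℕ => (c + 1) ^ 2 :=
    (Primrec.nat_mul.comp Primrec.succ Primrec.succ).of_eq fun c => (sq (c + 1)).symm
  exact (Primrec₂.natPair.comp (Primrec.const 4) (Primrec₂.natPair.comp Primrec.id
    (h.comp Primrec.id hsq))).to_comp

open Classical in
theorem equivalent_exs_flatWitness (T : Theory sigF) (φ : QF sigF) :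
    T.Equivalent.{u} φ.1
      (Formula.exs ((flatWitness φ).1.vars \ φ.1.vars).toList (flatWitness φ).1) := by
  intro A _
  unfold Interp.Models
  rw [Formula.sat_exs]
  constructor
  · intro hφ
    let c := φ.1.code
    let F : ℕ → A.Dom () := fun m => A.func^[m.unpair.2] (A.val ⟨(), m.unpair.1⟩)
    -- The variables with index above `c` do not occur in `φ` and can take the values prescribed by
    -- the equations. All others keep their values.
    let μ : ∀ v : sigF.Var, A.Dom v.sort := fun v =>
      if c < v.idx ∧ v.idx - (c + 1) < (c + 1) ^ 2 then F (v.idx - (c + 1))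
      else A.val v
    have hμ : ∀ i ≤ c, μ ⟨(), i⟩ = A.val ⟨(), i⟩ := fun i hi =>
      if_neg fun h => absurd h.1 (not_lt.2 hi)
    have hμ' : ∀ m < (c + 1) ^ 2, μ ⟨(), c + 1 + m⟩ = F m := by
      intro m hm
      have h1 : c + 1 + m - (c + 1) = m := by omega
      have h2 : c < c + 1 + m ∧ c + 1 + m - (c + 1) < (c + 1) ^ 2 := ⟨by omega, h1.symm ▸ hm⟩
      exact (if_pos h2).trans (congrArg F h1)
    refine ⟨μ, ?_, ?_, (sat_flattening A μ _ _).2 fun m hm => ?_⟩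
    · rintro ⟨⟨⟩, i⟩ hv
      by_contra hne
      apply hv
      have hi : c < i ∧ i - (c + 1) < (c + 1) ^ 2 := by
        by_contra h
        exact hne (if_neg h)
      rw [Finset.mem_toList, Finset.mem_sdiff]
      constructor
      · have h := (mem_vars_flattening (c := c) hi.2).1
        rw [Nat.add_sub_of_le hi.1] at h
        exact Finset.mem_union_right _ h
      · intro h
        exact absurd hi.1 (not_lt.2 (idx_le_code_of_mem_vars φ.1 φ.2 _ h))
    · refine (sat_iff_of_iterate_eq (A := A) (B := A) (e := id) injective_id φ.1 φ.2
        fun i k hi _ => ?_).1 hφ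
      rw [hμ i hi]
      rfl
    · rw [hμ' m hm, hμ _ (unpair_le_of_lt_sq hm).1]
  · rintro ⟨μ, h, hμ, -⟩
    refine (φ.1.sat_congr A.toStruct fun v hv => h v ?_).1 hμ
    simp [hv]

/-- A model of the witness can be cut down to the values of finitely many variables. -/
theorem IsPeriodTheory.exists_coveredBy {T : Theory sigF} {S : Set ℕ} {Q : Set ℕ → Prop}
    (hT : IsPeriodTheory.{u} T S Q) (φ : QF sigF) {V : Finset sigF.Var}
    (hV : (flatWitness φ).1.vars ⊆ V) {A : Interp.{u} sigF} (hA : T.IsInterp A)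
    (hφ : A.Models (flatWitness φ).1) :
    ∃ B : Interp.{u} sigF, T.IsInterp B ∧ B.Models (flatWitness φ).1 ∧ B.CoveredBy {()} V ∧
      ∀ x ∈ V, ∀ y ∈ V, B.val ⟨(), x.idx⟩ = B.val ⟨(), y.idx⟩ ↔
        A.val ⟨(), x.idx⟩ = A.val ⟨(), y.idx⟩ := by
  classical
  let W : Set (A.Dom ()) := {a | ∃ i : ℕ, (⟨(), i⟩ : sigF.Var) ∈ V ∧ A.val ⟨(), i⟩ = a}
  have hW0 : A.val ⟨(), 0⟩ ∈ W := ⟨0, hV (mem_vars_flatWitness φ (Nat.zero_le _)), rfl⟩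
  have hflat := (sat_flattening A A.val _ _).1 hφ.2
  -- The equations name these iterates, so `W` contains every value relevant to `φ`, and `g` agrees
  -- with `f` on the way there.
  have hWf : ∀ i k, i ≤ φ.1.code → k ≤ φ.1.code → A.func^[k] (A.val ⟨(), i⟩) ∈ W := by
    intro i k hi hk
    refine ⟨_, hV (mem_vars_flatWitness_pair φ hi hk), ?_⟩
    rw [hflat _ (pair_lt_sq_of_le hi hk), Nat.unpair_pair]
  obtain ⟨g, hg, hper⟩ := exists_restrict_periods A.func W ⟨_, hW0⟩
  -- Variables outside `V` get an arbitrary value in `W`.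
  let v : ℕ → W := fun i =>
    if h : (⟨(), i⟩ : sigF.Var) ∈ V then ⟨A.val ⟨(), i⟩, i, h, rfl⟩ else ⟨_, hW0⟩
  have hv : ∀ i, (⟨(), i⟩ : sigF.Var) ∈ V → (v i : A.Dom ()) = A.val ⟨(), i⟩ := fun i h => by
    simp [v, h]
  let B : Interp.{u} sigF := Interp.ofMap g v
  have hiter : ∀ i k, i ≤ φ.1.code → k ≤ φ.1.code →
      (g^[k] (v i) : A.Dom ()) = A.func^[k] (A.val ⟨(), i⟩) := by
    intro i k hi hk
    induction k with
    | zero => exact hv i (hV (mem_vars_flatWitness φ hi))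
    | succ k ih =>
      have ih := ih (by omega)
      have hmem := hWf i (k + 1) hi hk
      rw [iterate_succ_apply'] at hmem ⊢
      rw [iterate_succ_apply', hg _ (ih ▸ hmem), ih]
  refine ⟨B, (hT.isInterp_iff B).2 ?_, ⟨?_, (sat_flattening B B.val _ _).2 ?_⟩, ?_, ?_⟩
  · rcases hper with h | h
    · exact hT.mono h ((hT.isInterp_iff A).1 hA)
    · exact hT.mono h hT.one
  · exact (sat_iff_of_iterate_eq (A := B) (B := A) (μ := B.val) (ν := A.val)
      (e := Subtype.val) Subtype.val_injective φ.1 φ.2 hiter).2 hφ.1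
  · intro m hm
    obtain ⟨h1, h2⟩ := unpair_le_of_lt_sq hm
    apply Subtype.ext
    refine ((hv _ ?_).trans (hflat m hm)).trans (hiter _ _ h1 h2).symm
    exact hV (Finset.mem_union_right _ (mem_vars_flattening hm).1)
  · rintro ⟨⟩ - ⟨a, i, hi, rfl⟩
    exact ⟨i, hi, Subtype.ext (hv i hi)⟩
  · intro x hx y hy
    change v x.idx = v y.idx ↔ _
    rw [← Subtype.val_injective.eq_iff, hv _ hx, hv _ hy]

/-- Both covering conditions come from the same cut-down. It preserves all equalities between the
variables of `V`, hence any arrangement on them. -/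
theorem IsPeriodTheory.isStrongWitness {T : Theory sigF} {S : Set ℕ} {Q : Set ℕ → Prop}
    (hT : IsPeriodTheory.{u} T S Q) : T.IsStrongWitness.{u} {()} flatWitness := by
  classical
  refine ⟨⟨exists_computable_flatWitness, equivalent_exs_flatWitness T, ?_⟩, ?_⟩
  · rintro φ ⟨A, hA, hφ⟩
    obtain ⟨B, hB, hBφ, hc, -⟩ := hT.exists_coveredBy φ subset_rfl hA hφ
    exact ⟨B, hB, hBφ.1, hc⟩
  · rintro φ V E - - ⟨A, hA, hφ, harr⟩
    obtain ⟨B, hB, hBφ, hc, hval⟩ := hT.exists_coveredBy φ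
      (V := (Formula.and (flatWitness φ).1 (arrangement V E)).vars)
      (fun v hv => Finset.mem_union_left _ hv) hA hφ
    have hV : V ⊆ (Formula.and (flatWitness φ).1 (arrangement V E)).vars :=
      fun v hv => Finset.mem_union_right _ (subset_vars_arrangement V E hv)
    refine ⟨B, hB, ⟨hBφ, (sat_arrangement_sigF B V E).2 fun x hx y hy => ?_⟩, hc⟩
    rw [hval x (hV hx) y (hV hy)]
    exact (sat_arrangement_sigF A V E).1 harr x hx y hy

theorem IsPeriodTheory.stronglyPolite {T : Theory sigF} {S : Set ℕ} {Q : Set ℕ → Prop}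
    (hT : IsPeriodTheory.{u} T S Q) : T.StronglyPolite.{u} {()} :=
  ⟨hT.smooth, _, hT.isStrongWitness⟩

/-! ### Undecidable sets of primes -/

/-- A counting argument: there are uncountably many sets of primes `≥ 7`, but only countably many
programs. -/
theorem exists_isUndecidablePrimeSet : ∃ S : Set ℕ, IsUndecidablePrimeSet S := by
  classical
  by_contra! hcon
  have hinf : {p : ℕ | p.Prime ∧ 7 ≤ p}.Infinite := by
    refine Set.infinite_of_not_bddAbove fun ⟨b, hb⟩ => ?_
    obtain ⟨p, hp, hpp⟩ := Nat.exists_infinite_primes (b + 8)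
    have := hb ⟨hpp, by omega⟩
    omega
  let e := hinf.natEmbedding
  let E : Set ℕ → Set ℕ := fun A => {p | ∃ n ∈ A, (e n : ℕ) = p}
  have hE : ∀ A n, (e n : ℕ) ∈ E A ↔ n ∈ A := by
    intro A n
    constructor
    · rintro ⟨m, hm, h⟩
      rwa [e.injective (Subtype.ext h)] at hm
    · exact fun h => ⟨n, h, rfl⟩
  have hdec : ∀ A, ComputablePred fun n : ℕ => n ∈ E A := by
    intro A
    by_contra h
    refine hcon (E A) ⟨?_, h⟩
    rintro _ ⟨n, -, rfl⟩
    exact (e n).2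
  have hcode : ∀ A, ∃ c : Nat.Partrec.Code,
      c.eval = fun n => Part.some (Encodable.encode (decide (n ∈ E A))) := by
    intro A
    obtain ⟨_, h⟩ := hdec A
    obtain ⟨c, hc⟩ := Nat.Partrec.Code.exists_code.1
      (Partrec.nat_iff.1 (Computable.encode.comp h).partrec)
    refine ⟨c, hc.trans (funext fun n => ?_)⟩
    exact congrArg (fun b : Bool => Part.some (Encodable.encode b)) (decide_eq_decide.2 Iff.rfl)
  choose c hc using hcode
  -- If every such set were decidable, sending `A` to the number of a program deciding its copy `E
  -- A` would inject the power set of `ℕ` into `ℕ`.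
  refine cantor_injective (fun A => Encodable.encode (c A)) fun A B hAB => ?_
  have h := (hc A).symm.trans ((Encodable.encode_injective hAB) ▸ hc B)
  ext n
  have h2 := Encodable.encode_injective (Part.some_injective (congrFun h (e n)))
  rw [← hE A, ← hE B]
  exact decide_eq_decide.1 h2

end ManySorted

/-- Strong politeness does not imply shininess or decidability. -/
theorem mainTheorem3 :
    (∃ (Sg : ManySorted.Signature) (_ : Sg.Effective) (T : ManySorted.Theory Sg)
      (R : Set Sg.Sorts), R.Finite ∧
        T.StronglyPolite.{u} R ∧ ¬ T.Shiny.{u} R ∧ ¬ T.IsDecidable.{u}) ∧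
    (∃ S : Set ℕ, ManySorted.IsUndecidablePrimeSet S) ∧
    ∀ S : Set ℕ, ManySorted.IsUndecidablePrimeSet S →
      ∀ T : ManySorted.Theory ManySorted.sigF, T = ManySorted.T₁ S ∨ T = ManySorted.T₂ S →
        T.StablyInfinite.{u} {()} ∧ T.Unicorn2.{u} {()} ∧
        T.StronglyPolite.{u} {()} ∧ ¬ T.Shiny.{u} {()} ∧ ¬ T.IsDecidable.{u} := by
  have key : ∀ S : Set ℕ, ManySorted.IsUndecidablePrimeSet S →
      ∀ T : ManySorted.Theory ManySorted.sigF, T = ManySorted.T₁ S ∨ T = ManySorted.T₂ S →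
        T.StablyInfinite.{u} {()} ∧ T.Unicorn2.{u} {()} ∧
        T.StronglyPolite.{u} {()} ∧ ¬ T.Shiny.{u} {()} ∧ ¬ T.IsDecidable.{u} := by
    intro S hS T hT
    have h7 : ∀ p ∈ S, 7 ≤ p := fun p hp => (hS.1 p hp).2
    obtain ⟨Q, hQ⟩ : ∃ Q, ManySorted.IsPeriodTheory.{u} T S Q := by
      rcases hT with rfl | rfl
      · exact ⟨_, ManySorted.isPeriodTheory_T₁ h7⟩
      · exact ⟨_, ManySorted.isPeriodTheory_T₂ h7⟩
    have hMMF := hQ.not_hasComputableMMF h7 hS.2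
    exact ⟨hQ.smooth.stablyInfinite, ⟨hQ.stronglyPolite.2, hMMF⟩, hQ.stronglyPolite,
      fun h => hMMF h.2.2, hQ.not_isDecidable h7 hS.2⟩
  obtain ⟨S, hS⟩ := ManySorted.exists_isUndecidablePrimeSet
  obtain ⟨-, -, h1, h2, h3⟩ := key S hS _ (Or.inl rfl)
  exact ⟨⟨_, _, _, _, Set.finite_singleton (), h1, h2, h3⟩, ⟨S, hS⟩, key⟩
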